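/- **Theorem (Completeness of declarative subsorting for LF with refinements).** *Syntax* (up to $\alpha$-equivalence; $c$, $a$, $s$ range over term, type and sort constants): atomic terms $R ::= c \mid x \mid R\,N$; normal terms $N ::= R \mid \lambda x.N$; atomic types $P ::= a \mid P\,N$; types $A ::= P \mid \Pi x{:}A_1.A_2$; kinds $K ::= \mathsf{type} \mid \Pi x{:}A.K$; atomic sorts $Q ::= s \mid Q\,N$; sorts $S,T ::= Q \mid \Pi x{::}S_1{\sqsubset}A_1.S_2 \mid \top \mid S_1\wedge S_2$; classes $L ::= \mathsf{sort} \mid \Pi x{::}S{\sqsubset}A.L \mid \top \mid L_1\wedge L_2$. A signature $\Sigma$ is a list of declarations $a{:}K$, $c{:}A$, $s\sqsubset a::L$, $s_1\le s_2$, $c::S$; a context $\Gamma$ is a list of declarations $x{::}S{\sqsubset}A$, and $\Gamma^*$ denotes the LF context obtained by replacing each of them by $x{:}A$. Simple types are $\alpha ::= a \mid \alpha_1\to\alpha_2$; a type $A$ erases to the simple type $A^-$ by $(a\,N_1\cdots N_n)^-=a$, $(\Pi x{:}A.B)^-=A^-\to B^-$. The $\eta$-expansion is $\eta_a(R)=R$,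 $\eta_{\alpha\to\beta}(R)=\lambda x.\,\eta_\beta(R\,(\eta_\alpha(x)))$, and $\eta_A=\eta_{A^-}$. *Hereditary substitution* $[N_0/x_0]_{\alpha_0}$ is the partial function that is compositional on all syntactic categories except at atomic terms $R$ with head $x_0$. For these there is an auxiliary partial function with values (normal term, simple type): $x_0\mapsto(N_0,\alpha_0)$, and if $R_1\mapsto(\lambda x.N_1,\alpha_2\to\alpha_1)$, $[N_0/x_0]_{\alpha_0}N_2=N_2'$ and $[N_2'/x]_{\alpha_2}N_1=N_1'$, then $R_1\,N_2\mapsto(N_1',\alpha_1)$; and $[N_0/x_0]_{\alpha_0}R=R'$ if $R\mapsto(R',a)$ with $R'$ atomic. We write $[N/x]_A$ for $[N/x]_{A^-}$. *Sorting.* Atomic subsorting $Q_1\le Q_2$ is the reflexive-transitive closure of $s_1\,N_1\cdots N_n\le s_2\,N_1\cdots N_n$ for $s_1\le s_2\in\Sigma$. Synthesis: $\Gamma\vdash c\Rightarrow S$ if $c::S\in\Sigma$; $\Gamma\vdash x\Rightarrow S$ if $x{::}S{\sqsubset}A\in\Gamma$; $\Gamma\vdash R\,N\Rightarrow [N/x]_A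 T$ if $\Gamma\vdash R\Rightarrow\Pi x{::}S{\sqsubset}A.T$, $\Gamma\vdash N\Leftarrow S$ and the substitution is defined; $\Gamma\vdash R\Rightarrow S_i$ if $\Gamma\vdash R\Rightarrow S_1\wedge S_2$. Checking: $\Gamma\vdash R\Leftarrow Q$ if $\Gamma\vdash R\Rightarrow Q'$ and $Q'\le Q$; $\Gamma\vdash\lambda x.N\Leftarrow\Pi x{::}S{\sqsubset}A.T$ if $\Gamma,x{::}S{\sqsubset}A\vdash N\Leftarrow T$; $\Gamma\vdash N\Leftarrow\top$ always; $\Gamma\vdash N\Leftarrow S_1\wedge S_2$ if $\Gamma\vdash N\Leftarrow S_1$ and $\Gamma\vdash N\Leftarrow S_2$. *Refinement.* $\Gamma\vdash s\sqsubset a\Rightarrow L$ if $s\sqsubset a::L\in\Sigma$; $\Gamma\vdash Q\,N\sqsubset P\,N\Rightarrow[N/x]_A L$ if $\Gamma\vdash Q\sqsubset P\Rightarrow\Pi x{::}S{\sqsubset}A.L$, $\Gamma\vdash N\Leftarrow S$ and the substitution is defined; $\Gamma\vdash Q\sqsubset P\Rightarrow L_i$ if $\Gamma\vdash Q\sqsubset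 P\Rightarrow L_1\wedge L_2$. Then $\Gamma\vdash Q\sqsubset P$ if $\Gamma\vdash Q\sqsubset P\Rightarrow\mathsf{sort}$; $\Gamma\vdash\Pi x{::}S{\sqsubset}A.S'\sqsubset\Pi x{:}A.A'$ if $\Gamma\vdash S\sqsubset A$ and $\Gamma,x{::}S{\sqsubset}A\vdash S'\sqsubset A'$; $\Gamma\vdash\top\sqsubset A$ always; $\Gamma\vdash S_1\wedge S_2\sqsubset A$ if $\Gamma\vdash S_1\sqsubset A$ and $\Gamma\vdash S_2\sqsubset A$. Refinement $L\sqsubset K$ of kinds by classes is defined in the same way from $\mathsf{sort}\sqsubset\mathsf{type}$. $\Sigma$ is well formed if each of its declarations is well formed over the preceding ones: $a{:}K$ with $K$ a kind and $c{:}A$ with $A$ a type of canonical LF; $s\sqsubset a::L$ with $a{:}K$ declared and $L\sqsubset K$; $c::S$ with $c{:}A$ declared and $S\sqsubset A$; $s_1\le s_2$ with $s_1\sqsubset a::L$ and $s_2\sqsubset a::L$ declared for the same $a$ and $L$; and each constant has at most one declaration of each of the first four forms. $\Gamma$ is well formed if for each of its declarations $x{::}S{\sqsubset}A$, over the preceding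 part $\Gamma_0$, $A$ is a type of canonical LF in $\Gamma_0^*$ and $\Gamma_0\vdash S\sqsubset A$. *Declarative subsorting* $\Gamma\vdash S\le T\sqsubset A$, between sorts $S,T$ that refine the same type $A$ in $\Gamma$ (for every judgment in a derivation, both sorts are required to refine the indicated type in the indicated context; the indices $\Gamma$, $A$ are usually omitted), is generated by atomic subsorting $Q_1\le Q_2$ and the rules: $S\le S$; from $S_1\le S_2$ and $S_2\le S_3$ infer $S_1\le S_3$; from $\Gamma\vdash S_2\le S_1\sqsubset A$ and $\Gamma,x{::}S_2{\sqsubset}A\vdash T_1\le T_2\sqsubset A'$ infer $\Gamma\vdash\Pi x{::}S_1{\sqsubset}A.T_1\le\Pi x{::}S_2{\sqsubset}A.T_2\sqsubset\Pi x{:}A.A'$; $S\le\top$; from $T\le S_1$ and $T\le S_2$ infer $T\le S_1\wedge S_2$; from $S_i\le T$ infer $S_1\wedge S_2\le T$ ($i=1,2$); $\top\le\Pi x{::}S{\sqsubset}A.\top$; $(\Pi x{::}S{\sqsubset}A.T_1)\wedge(\Pi x{::}S{\sqsubset}A.T_2)\le\Pi x{::}S{\sqsubset}A.(T_1\wedge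 T_2)$. *Claim.* Let $\Sigma$ be a well-formed signature, $\Gamma$ a well-formed context, $A$ a well-formed type of canonical LF in $\Gamma^*$, and $S,T$ sorts with $\Gamma\vdash S\sqsubset A$ and $\Gamma\vdash T\sqsubset A$. If $$\Gamma,\,x{::}S{\sqsubset}A\;\vdash\;\eta_A(x)\Leftarrow T,$$ then $\Gamma\vdash S\le T\sqsubset A$ is derivable; in particular $S\le T$ is derivable with the declarative subsorting rules. -/

import Mathlib

/-!
LF with refinements (LFR), canonical-forms presentation.

Bound and context variables are de Bruijn indices, so that α-equivalent objects are equal.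
A context is a list whose head is the most recent declaration.  A signature is likewise a list
whose head is the most recent declaration.  Term constants `c`, type constants `a` and sort
constants `s` are three separate families of names, each indexed by natural numbers.
-/

namespace LFR

/-! ### Grammar -/

mutual
/-- Atomic terms `R ::= c | x | R N`. -/
inductive Atom : Type
  | const (c : ℕ) : Atom
  | var (i : ℕ) : Atom
  | app (R : Atom) (N : Norm) : Atom
/-- Normal terms `N ::= R | λx. N`. -/
inductive Norm : Type
  | atom (R : Atom) : Norm
  | lam (N : Norm) : Norm
end

/-- Atomic type families `P ::= a | P N`. -/
inductive AtomTy : Type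
  | const (a : ℕ) : AtomTy
  | app (P : AtomTy) (N : Norm) : AtomTy

/-- Normal type families `A ::= P | Πx:A₁. A₂`. -/
inductive Ty : Type
  | atom (P : AtomTy) : Ty
  | pi (A₁ A₂ : Ty) : Ty

/-- Kinds `K ::= type | Πx:A. K`. -/
inductive Knd : Type
  | type : Knd
  | pi (A : Ty) (K : Knd) : Knd

/-- Atomic sort families `Q ::= s | Q N`. -/
inductive AtomSrt : Type
  | const (s : ℕ) : AtomSrt
  | app (Q : AtomSrt) (N : Norm) : AtomSrt

/-- Normal sort families `S ::= Q | Πx::S₁⊏A₁. S₂ | ⊤ | S₁ ∧ S₂`. -/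
inductive Srt : Type
  | atom (Q : AtomSrt) : Srt
  | pi (S₁ : Srt) (A₁ : Ty) (S₂ : Srt) : Srt
  | top : Srt
  | inter (S₁ S₂ : Srt) : Srt

/-- Classes `L ::= sort | Πx::S⊏A. L | ⊤ | L₁ ∧ L₂`. -/
inductive Cls : Type
  | sort : Cls
  | pi (S : Srt) (A : Ty) (L : Cls) : Cls
  | top : Cls
  | inter (L₁ L₂ : Cls) : Cls

/-- Signature declarations `a : K`, `c : A`, `s ⊏ a :: L`, `s₁ ≤ s₂`, `c :: S`. -/
inductive Decl : Type
  | tyConst (a : ℕ) (K : Knd) : Decl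
  | tmConst (c : ℕ) (A : Ty) : Decl
  | srtConst (s a : ℕ) (L : Cls) : Decl
  | subsort (s₁ s₂ : ℕ) : Decl
  | tmSrt (c : ℕ) (S : Srt) : Decl

abbrev Sig : Type := List Decl

/-- LFR contexts: a list of declarations `x :: S ⊏ A`. -/
abbrev Ctx : Type := List (Srt × Ty)

/-- The LF context underlying an LFR context: each `x :: S ⊏ A` becomes `x : A`. -/
def Ctx.erase (Γ : Ctx) : List Ty := Γ.map Prod.snd

/-! ### Renaming of variables -/

/-- Extension of a renaming under one binder. -/
def upRen (ξ : ℕ → ℕ) : ℕ → ℕ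
  | 0 => 0
  | i + 1 => ξ i + 1

mutual
def Atom.ren (ξ : ℕ → ℕ) : Atom → Atom
  | .const c => .const c
  | .var i => .var (ξ i)
  | .app R N => .app (R.ren ξ) (N.ren ξ)
def Norm.ren (ξ : ℕ → ℕ) : Norm → Norm
  | .atom R => .atom (R.ren ξ)
  | .lam N => .lam (N.ren (upRen ξ))
end

def AtomTy.ren (ξ : ℕ → ℕ) : AtomTy → AtomTy
  | .const a => .const a
  | .app P N => .app (P.ren ξ) (N.ren ξ)

def Ty.ren (ξ : ℕ → ℕ) : Ty → Ty
  | .atom P => .atom (P.ren ξ)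
  | .pi A₁ A₂ => .pi (A₁.ren ξ) (A₂.ren (upRen ξ))

def AtomSrt.ren (ξ : ℕ → ℕ) : AtomSrt → AtomSrt
  | .const s => .const s
  | .app Q N => .app (Q.ren ξ) (N.ren ξ)

def Srt.ren (ξ : ℕ → ℕ) : Srt → Srt
  | .atom Q => .atom (Q.ren ξ)
  | .pi S₁ A₁ S₂ => .pi (S₁.ren ξ) (A₁.ren ξ) (S₂.ren (upRen ξ))
  | .top => .top
  | .inter S₁ S₂ => .inter (S₁.ren ξ) (S₂.ren ξ)

/-- Weakening by one new most recent variable. -/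
def Atom.shift (R : Atom) : Atom := R.ren Nat.succ
def Norm.shift (N : Norm) : Norm := N.ren Nat.succ
def Ty.shift (A : Ty) : Ty := A.ren Nat.succ
def Srt.shift (S : Srt) : Srt := S.ren Nat.succ

/-- `Lookup Γ i S`: variable `i` is declared with sort `S` in `Γ`. -/
inductive Lookup : Ctx → ℕ → Srt → Prop
  | zero (Γ : Ctx) (S : Srt) (A : Ty) : Lookup ((S, A) :: Γ) 0 S.shift
  | succ {Γ : Ctx} {i : ℕ} {S : Srt} (d : Srt × Ty) :
      Lookup Γ i S → Lookup (d :: Γ) (i + 1) S.shift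

/-- `LookupTy Γ i A`: variable `i` is declared with type `A` in the LF context `Γ`. -/
inductive LookupTy : List Ty → ℕ → Ty → Prop
  | zero (Γ : List Ty) (A : Ty) : LookupTy (A :: Γ) 0 A.shift
  | succ {Γ : List Ty} {i : ℕ} {A : Ty} (B : Ty) :
      LookupTy Γ i A → LookupTy (B :: Γ) (i + 1) A.shift

/-! ### Simple types and η-expansion -/

/-- Simple types `α ::= a | α₁ → α₂`. -/
inductive STy : Type
  | base (a : ℕ) : STy
  | arr (α₁ α₂ : STy) : STy

def AtomTy.erase : AtomTy → STy
  | .const a => .base a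
  | .app P _ => P.erase

/-- Erasure of a dependent type to a simple type. -/
def Ty.erase : Ty → STy
  | .atom P => P.erase
  | .pi A₁ A₂ => .arr A₁.erase A₂.erase

/-- η-expansion: `η_a(R) = R` and `η_{α→β}(R) = λx. η_β(R (η_α(x)))`. -/
def eta : STy → Atom → Norm
  | .base _, R => .atom R
  | .arr α β, R => .lam (eta β (.app R.shift (eta α (.var 0))))

/-! ### Hereditary substitution

`HSubN k N₀ α₀ N N'` is `[N₀/x]_{α₀} N = N'` where `x` is the variable with index `k` in `N`.
The index `k` is removed: larger indices drop by one.  The term `N₀` and the result live in the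
context without `x`. -/

mutual
/-- Substitution into normal terms. -/
inductive HSubN : ℕ → Norm → STy → Norm → Norm → Prop
  | atomNorm {k : ℕ} {N₀ : Norm} {α₀ : STy} {R R' : Atom} {a : ℕ} :
      HSubRN k N₀ α₀ R (.atom R') (.base a) → HSubN k N₀ α₀ (.atom R) (.atom R')
  | atom {k : ℕ} {N₀ : Norm} {α₀ : STy} {R R' : Atom} :
      HSubRR k N₀ α₀ R R' → HSubN k N₀ α₀ (.atom R) (.atom R')
  | lam {k : ℕ} {N₀ : Norm} {α₀ : STy} {N M : Norm} :
      HSubN (k + 1) N₀.shift α₀ N M → HSubN k N₀ α₀ (.lam N) (.lam M)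
/-- Substitution into atomic terms whose head is not the substituted variable. -/
inductive HSubRR : ℕ → Norm → STy → Atom → Atom → Prop
  | varLt {k : ℕ} {N₀ : Norm} {α₀ : STy} {i : ℕ} :
      i < k → HSubRR k N₀ α₀ (.var i) (.var i)
  | varGt {k : ℕ} {N₀ : Norm} {α₀ : STy} {i : ℕ} :
      k ≤ i → HSubRR k N₀ α₀ (.var (i + 1)) (.var i)
  | const {k : ℕ} {N₀ : Norm} {α₀ : STy} {c : ℕ} :
      HSubRR k N₀ α₀ (.const c) (.const c)
  | app {k : ℕ} {N₀ : Norm} {α₀ : STy} {R R' : Atom} {N M : Norm} :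
      HSubRR k N₀ α₀ R R' → HSubN k N₀ α₀ N M →
      HSubRR k N₀ α₀ (.app R N) (.app R' M)
/-- Substitution into atomic terms whose head is the substituted variable. -/
inductive HSubRN : ℕ → Norm → STy → Atom → Norm → STy → Prop
  | var {k : ℕ} {N₀ : Norm} {α₀ : STy} :
      HSubRN k N₀ α₀ (.var k) N₀ α₀
  | beta {k : ℕ} {N₀ : Norm} {α₀ : STy} {R₁ : Atom} {N₁ N₁' N₂ N₂' : Norm} {α₁ α₂ : STy} :
      HSubRN k N₀ α₀ R₁ (.lam N₁) (.arr α₂ α₁) → HSubN k N₀ α₀ N₂ N₂' →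
      HSubN 0 N₂' α₂ N₁ N₁' → HSubRN k N₀ α₀ (.app R₁ N₂) N₁' α₁
end

inductive HSubP (k : ℕ) (N₀ : Norm) (α₀ : STy) : AtomTy → AtomTy → Prop
  | const {a : ℕ} : HSubP k N₀ α₀ (.const a) (.const a)
  | app {P P' : AtomTy} {N N' : Norm} :
      HSubP k N₀ α₀ P P' → HSubN k N₀ α₀ N N' → HSubP k N₀ α₀ (.app P N) (.app P' N')

inductive HSubA : ℕ → Norm → STy → Ty → Ty → Prop
  | atom {k : ℕ} {N₀ : Norm} {α₀ : STy} {P P' : AtomTy} :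
      HSubP k N₀ α₀ P P' → HSubA k N₀ α₀ (.atom P) (.atom P')
  | pi {k : ℕ} {N₀ : Norm} {α₀ : STy} {A A' B B' : Ty} :
      HSubA k N₀ α₀ A A' → HSubA (k + 1) N₀.shift α₀ B B' →
      HSubA k N₀ α₀ (.pi A B) (.pi A' B')

inductive HSubK : ℕ → Norm → STy → Knd → Knd → Prop
  | type {k : ℕ} {N₀ : Norm} {α₀ : STy} : HSubK k N₀ α₀ .type .type
  | pi {k : ℕ} {N₀ : Norm} {α₀ : STy} {A A' : Ty} {K K' : Knd} :
      HSubA k N₀ α₀ A A' → HSubK (k + 1) N₀.shift α₀ K K' →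
      HSubK k N₀ α₀ (.pi A K) (.pi A' K')

inductive HSubQ (k : ℕ) (N₀ : Norm) (α₀ : STy) : AtomSrt → AtomSrt → Prop
  | const {s : ℕ} : HSubQ k N₀ α₀ (.const s) (.const s)
  | app {Q Q' : AtomSrt} {N N' : Norm} :
      HSubQ k N₀ α₀ Q Q' → HSubN k N₀ α₀ N N' → HSubQ k N₀ α₀ (.app Q N) (.app Q' N')

inductive HSubS : ℕ → Norm → STy → Srt → Srt → Prop
  | atom {k : ℕ} {N₀ : Norm} {α₀ : STy} {Q Q' : AtomSrt} :
      HSubQ k N₀ α₀ Q Q' → HSubS k N₀ α₀ (.atom Q) (.atom Q')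
  | pi {k : ℕ} {N₀ : Norm} {α₀ : STy} {S S' T T' : Srt} {A A' : Ty} :
      HSubS k N₀ α₀ S S' → HSubA k N₀ α₀ A A' → HSubS (k + 1) N₀.shift α₀ T T' →
      HSubS k N₀ α₀ (.pi S A T) (.pi S' A' T')
  | top {k : ℕ} {N₀ : Norm} {α₀ : STy} : HSubS k N₀ α₀ .top .top
  | inter {k : ℕ} {N₀ : Norm} {α₀ : STy} {S₁ S₁' S₂ S₂' : Srt} :
      HSubS k N₀ α₀ S₁ S₁' → HSubS k N₀ α₀ S₂ S₂' →
      HSubS k N₀ α₀ (.inter S₁ S₂) (.inter S₁' S₂')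

inductive HSubL : ℕ → Norm → STy → Cls → Cls → Prop
  | sort {k : ℕ} {N₀ : Norm} {α₀ : STy} : HSubL k N₀ α₀ .sort .sort
  | pi {k : ℕ} {N₀ : Norm} {α₀ : STy} {S S' : Srt} {A A' : Ty} {L L' : Cls} :
      HSubS k N₀ α₀ S S' → HSubA k N₀ α₀ A A' → HSubL (k + 1) N₀.shift α₀ L L' →
      HSubL k N₀ α₀ (.pi S A L) (.pi S' A' L')
  | top {k : ℕ} {N₀ : Norm} {α₀ : STy} : HSubL k N₀ α₀ .top .top
  | inter {k : ℕ} {N₀ : Norm} {α₀ : STy} {L₁ L₂ M₁ M₂ : Cls} :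
      HSubL k N₀ α₀ L₁ M₁ → HSubL k N₀ α₀ L₂ M₂ →
      HSubL k N₀ α₀ (.inter L₁ L₂) (.inter M₁ M₂)

/-! ### Canonical LF

These judgments consult only the declarations `a : K` and `c : A` of the signature, so they are
the judgments over the LF part of the signature. -/

mutual
/-- `Γ ⊢ R ⇒ A`. -/
inductive TmSynth (Sg : Sig) : List Ty → Atom → Ty → Prop
  | var {Γ : List Ty} {i : ℕ} {A : Ty} : LookupTy Γ i A → TmSynth Sg Γ (.var i) A
  | const {Γ : List Ty} {c : ℕ} {A : Ty} : Decl.tmConst c A ∈ Sg → TmSynth Sg Γ (.const c) A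
  | app {Γ : List Ty} {R : Atom} {N : Norm} {A B C : Ty} :
      TmSynth Sg Γ R (.pi A B) → TmCheck Sg Γ N A → HSubA 0 N A.erase B C →
      TmSynth Sg Γ (.app R N) C
/-- `Γ ⊢ N ⇐ A`. -/
inductive TmCheck (Sg : Sig) : List Ty → Norm → Ty → Prop
  | switch {Γ : List Ty} {R : Atom} {P : AtomTy} :
      TmSynth Sg Γ R (.atom P) → TmCheck Sg Γ (.atom R) (.atom P)
  | lam {Γ : List Ty} {N : Norm} {A B : Ty} :
      TmCheck Sg (A :: Γ) N B → TmCheck Sg Γ (.lam N) (.pi A B)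
end

/-- `Γ ⊢ P ⇒ K`. -/
inductive TySynth (Sg : Sig) (Γ : List Ty) : AtomTy → Knd → Prop
  | const {a : ℕ} {K : Knd} : Decl.tyConst a K ∈ Sg → TySynth Sg Γ (.const a) K
  | app {P : AtomTy} {N : Norm} {A : Ty} {K K₁ : Knd} :
      TySynth Sg Γ P (.pi A K) → TmCheck Sg Γ N A → HSubK 0 N A.erase K K₁ →
      TySynth Sg Γ (.app P N) K₁

/-- `Γ ⊢ A ⇐ type`. -/
inductive TyOK (Sg : Sig) : List Ty → Ty → Prop
  | atom {Γ : List Ty} {P : AtomTy} : TySynth Sg Γ P .type → TyOK Sg Γ (.atom P)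
  | pi {Γ : List Ty} {A B : Ty} : TyOK Sg Γ A → TyOK Sg (A :: Γ) B → TyOK Sg Γ (.pi A B)

/-- `Γ ⊢ K kind`. -/
inductive KndOK (Sg : Sig) : List Ty → Knd → Prop
  | type {Γ : List Ty} : KndOK Sg Γ .type
  | pi {Γ : List Ty} {A : Ty} {K : Knd} :
      TyOK Sg Γ A → KndOK Sg (A :: Γ) K → KndOK Sg Γ (.pi A K)

/-! ### Sort checking -/

/-- One step `Q₁ ≤ Q₂` of declared subsorting, closed under application to equal arguments. -/
inductive AtomSubStep (Sg : Sig) : AtomSrt → AtomSrt → Prop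
  | decl {s₁ s₂ : ℕ} : Decl.subsort s₁ s₂ ∈ Sg → AtomSubStep Sg (.const s₁) (.const s₂)
  | app {Q₁ Q₂ : AtomSrt} {N : Norm} :
      AtomSubStep Sg Q₁ Q₂ → AtomSubStep Sg (.app Q₁ N) (.app Q₂ N)

/-- Subsorting `Q₁ ≤ Q₂` of atomic sorts: reflexive-transitive closure of the above. -/
inductive AtomSub (Sg : Sig) : AtomSrt → AtomSrt → Prop
  | refl {Q : AtomSrt} : AtomSub Sg Q Q
  | step {Q₁ Q' Q₂ : AtomSrt} :
      AtomSubStep Sg Q₁ Q' → AtomSub Sg Q' Q₂ → AtomSub Sg Q₁ Q₂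

mutual
/-- `Γ ⊢ R ⇒ S`. -/
inductive SortSynth (Sg : Sig) : Ctx → Atom → Srt → Prop
  | const {Γ : Ctx} {c : ℕ} {S : Srt} : Decl.tmSrt c S ∈ Sg → SortSynth Sg Γ (.const c) S
  | var {Γ : Ctx} {i : ℕ} {S : Srt} : Lookup Γ i S → SortSynth Sg Γ (.var i) S
  | app {Γ : Ctx} {R : Atom} {N : Norm} {S T T' : Srt} {A : Ty} :
      SortSynth Sg Γ R (.pi S A T) → SortCheck Sg Γ N S → HSubS 0 N A.erase T T' →
      SortSynth Sg Γ (.app R N) T'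
  | interE₁ {Γ : Ctx} {R : Atom} {S₁ S₂ : Srt} :
      SortSynth Sg Γ R (.inter S₁ S₂) → SortSynth Sg Γ R S₁
  | interE₂ {Γ : Ctx} {R : Atom} {S₁ S₂ : Srt} :
      SortSynth Sg Γ R (.inter S₁ S₂) → SortSynth Sg Γ R S₂
/-- `Γ ⊢ N ⇐ S`. -/
inductive SortCheck (Sg : Sig) : Ctx → Norm → Srt → Prop
  | switch {Γ : Ctx} {R : Atom} {Q Q' : AtomSrt} :
      SortSynth Sg Γ R (.atom Q') → AtomSub Sg Q' Q → SortCheck Sg Γ (.atom R) (.atom Q)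
  | lam {Γ : Ctx} {N : Norm} {S T : Srt} {A : Ty} :
      SortCheck Sg ((S, A) :: Γ) N T → SortCheck Sg Γ (.lam N) (.pi S A T)
  | top {Γ : Ctx} {N : Norm} : SortCheck Sg Γ N .top
  | inter {Γ : Ctx} {N : Norm} {S₁ S₂ : Srt} :
      SortCheck Sg Γ N S₁ → SortCheck Sg Γ N S₂ → SortCheck Sg Γ N (.inter S₁ S₂)
end

/-! ### Refinement -/

/-- `Γ ⊢ Q ⊏ P ⇒ L`: the atomic sort `Q` refines the atomic type `P` and has class `L`. -/
inductive ClsSynth (Sg : Sig) (Γ : Ctx) : AtomSrt → AtomTy → Cls → Prop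
  | const {s a : ℕ} {L : Cls} :
      Decl.srtConst s a L ∈ Sg → ClsSynth Sg Γ (.const s) (.const a) L
  | app {Q : AtomSrt} {P : AtomTy} {N : Norm} {S : Srt} {A : Ty} {L L' : Cls} :
      ClsSynth Sg Γ Q P (.pi S A L) → SortCheck Sg Γ N S → HSubL 0 N A.erase L L' →
      ClsSynth Sg Γ (.app Q N) (.app P N) L'
  | interE₁ {Q : AtomSrt} {P : AtomTy} {L₁ L₂ : Cls} :
      ClsSynth Sg Γ Q P (.inter L₁ L₂) → ClsSynth Sg Γ Q P L₁
  | interE₂ {Q : AtomSrt} {P : AtomTy} {L₁ L₂ : Cls} :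
      ClsSynth Sg Γ Q P (.inter L₁ L₂) → ClsSynth Sg Γ Q P L₂

/-- `Γ ⊢ S ⊏ A`: the sort `S` is well formed and refines the type `A`. -/
inductive Refines (Sg : Sig) : Ctx → Srt → Ty → Prop
  | atom {Γ : Ctx} {Q : AtomSrt} {P : AtomTy} :
      ClsSynth Sg Γ Q P .sort → Refines Sg Γ (.atom Q) (.atom P)
  | pi {Γ : Ctx} {S S' : Srt} {A A' : Ty} :
      Refines Sg Γ S A → Refines Sg ((S, A) :: Γ) S' A' →
      Refines Sg Γ (.pi S A S') (.pi A A')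
  | top {Γ : Ctx} {A : Ty} : Refines Sg Γ .top A
  | inter {Γ : Ctx} {S₁ S₂ : Srt} {A : Ty} :
      Refines Sg Γ S₁ A → Refines Sg Γ S₂ A → Refines Sg Γ (.inter S₁ S₂) A

/-- `Γ ⊢ L ⊏ K`. -/
inductive ClsRefines (Sg : Sig) : Ctx → Cls → Knd → Prop
  | sort {Γ : Ctx} : ClsRefines Sg Γ .sort .type
  | pi {Γ : Ctx} {S : Srt} {A : Ty} {L : Cls} {K : Knd} :
      Refines Sg Γ S A → ClsRefines Sg ((S, A) :: Γ) L K →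
      ClsRefines Sg Γ (.pi S A L) (.pi A K)
  | top {Γ : Ctx} {K : Knd} : ClsRefines Sg Γ .top K
  | inter {Γ : Ctx} {L₁ L₂ : Cls} {K : Knd} :
      ClsRefines Sg Γ L₁ K → ClsRefines Sg Γ L₂ K → ClsRefines Sg Γ (.inter L₁ L₂) K

/-! ### Well-formed signatures and contexts -/

/-- `Σ sig`. -/
inductive SigOK : Sig → Prop
  | nil : SigOK []
  | tyConst {Sg : Sig} {a : ℕ} {K : Knd} :
      SigOK Sg → KndOK Sg [] K → (∀ K', Decl.tyConst a K' ∉ Sg) →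
      SigOK (.tyConst a K :: Sg)
  | tmConst {Sg : Sig} {c : ℕ} {A : Ty} :
      SigOK Sg → TyOK Sg [] A → (∀ A', Decl.tmConst c A' ∉ Sg) →
      SigOK (.tmConst c A :: Sg)
  | srtConst {Sg : Sig} {s a : ℕ} {L : Cls} {K : Knd} :
      SigOK Sg → Decl.tyConst a K ∈ Sg → ClsRefines Sg [] L K →
      (∀ a' L', Decl.srtConst s a' L' ∉ Sg) → SigOK (.srtConst s a L :: Sg)
  | tmSrt {Sg : Sig} {c : ℕ} {A : Ty} {S : Srt} :
      SigOK Sg → Decl.tmConst c A ∈ Sg → Refines Sg [] S A →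
      (∀ S', Decl.tmSrt c S' ∉ Sg) → SigOK (.tmSrt c S :: Sg)
  | subsort {Sg : Sig} {s₁ s₂ a : ℕ} {L : Cls} :
      SigOK Sg → Decl.srtConst s₁ a L ∈ Sg → Decl.srtConst s₂ a L ∈ Sg →
      SigOK (.subsort s₁ s₂ :: Sg)

/-- `Γ ctx`: every declared sort refines its declared type, which is a well-formed LF type. -/
inductive CtxOK (Sg : Sig) : Ctx → Prop
  | nil : CtxOK Sg []
  | cons {Γ : Ctx} {S : Srt} {A : Ty} :
      CtxOK Sg Γ → TyOK Sg Γ.erase A → Refines Sg Γ S A → CtxOK Sg ((S, A) :: Γ)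

/-! ### Declarative subsorting at higher sorts -/

/-- `DeclSub Sg Γ S T A` is `Γ ⊢ S ≤ T ⊏ A`, declarative subsorting between sorts refining `A`.
The `Refines` premises are exactly what is needed for both sides of every derivable judgment
to refine `A` in `Γ`, so that only well-formed sorts occur in derivations.  Forgetting these
premises and the indices `Γ` and `A` turns a derivation into one of the bare rules for `S ≤ T`. -/
inductive DeclSub (Sg : Sig) : Ctx → Srt → Srt → Ty → Prop
  | atomic {Γ : Ctx} {Q₁ Q₂ : AtomSrt} {P : AtomTy} :
      Refines Sg Γ (.atom Q₁) (.atom P) → Refines Sg Γ (.atom Q₂) (.atom P) →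
      AtomSub Sg Q₁ Q₂ → DeclSub Sg Γ (.atom Q₁) (.atom Q₂) (.atom P)
  | refl {Γ : Ctx} {S : Srt} {A : Ty} :
      Refines Sg Γ S A → DeclSub Sg Γ S S A
  | trans {Γ : Ctx} {S₁ S₂ S₃ : Srt} {A : Ty} :
      DeclSub Sg Γ S₁ S₂ A → DeclSub Sg Γ S₂ S₃ A → DeclSub Sg Γ S₁ S₃ A
  | pi {Γ : Ctx} {S₁ S₂ T₁ T₂ : Srt} {A A' : Ty} :
      Refines Sg ((S₁, A) :: Γ) T₁ A' →
      DeclSub Sg Γ S₂ S₁ A → DeclSub Sg ((S₂, A) :: Γ) T₁ T₂ A' →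
      DeclSub Sg Γ (.pi S₁ A T₁) (.pi S₂ A T₂) (.pi A A')
  | topR {Γ : Ctx} {S : Srt} {A : Ty} :
      Refines Sg Γ S A → DeclSub Sg Γ S .top A
  | interR {Γ : Ctx} {S₁ S₂ T : Srt} {A : Ty} :
      DeclSub Sg Γ T S₁ A → DeclSub Sg Γ T S₂ A → DeclSub Sg Γ T (.inter S₁ S₂) A
  | interL₁ {Γ : Ctx} {S₁ S₂ T : Srt} {A : Ty} :
      Refines Sg Γ S₂ A → DeclSub Sg Γ S₁ T A → DeclSub Sg Γ (.inter S₁ S₂) T A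
  | interL₂ {Γ : Ctx} {S₁ S₂ T : Srt} {A : Ty} :
      Refines Sg Γ S₁ A → DeclSub Sg Γ S₂ T A → DeclSub Sg Γ (.inter S₁ S₂) T A
  | topPi {Γ : Ctx} {S : Srt} {A A' : Ty} :
      Refines Sg Γ S A → DeclSub Sg Γ .top (.pi S A .top) (.pi A A')
  | interPi {Γ : Ctx} {S T₁ T₂ : Srt} {A A' : Ty} :
      Refines Sg Γ S A → Refines Sg ((S, A) :: Γ) T₁ A' → Refines Sg ((S, A) :: Γ) T₂ A' →
      DeclSub Sg Γ (.inter (.pi S A T₁) (.pi S A T₂)) (.pi S A (.inter T₁ T₂)) (.pi A A')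

end LFR

/-!
Refinement is first weakened to a relation between the shapes of a sort and a type that mentions
neither signature nor context.  For such pairs a hereditary substitution into the sort exists as
soon as the one into the type does, and canonical LF supplies the latter.

The η-check `x :: S ⊢ η_A(x) ⇐ T` unfolds into a syntax-directed subsorting relation: the body of
`η_A(x)` applies `x` to η-expanded variables, and an application synthesizes `T'` from the
conjuncts `Π y :: U. T'` of the sorts of its function whose domain `U` is above that of the bound
variable.  The substitution `[η_B(y)/y']` into `T'` is a mere renaming, where it is defined, so no
new terms arise.

Conversely, the sorts above `S` in the declarative order form a filter `F`.  If `F` is a filter of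
sorts refining `Π x:A. B`, the distributivity rules make `{T | Π x::U. T ∈ F}` a filter of sorts
refining `B`, and by contravariance it contains the codomains selected by the algorithmic relation.
That these codomains refine `B` in the context with the smaller sort `U` is narrowing, which
rests on subsumption along algorithmic subsorting.
-/

namespace LFR

/-! ### Renaming -/

theorem upRen_id : upRen id = id := by
  funext i; cases i <;> rfl

theorem upRen_comp (f g : ℕ → ℕ) : upRen g ∘ upRen f = upRen (g ∘ f) := by
  funext i; cases i <;> rfl

mutual
theorem Atom.ren_ren (f g : ℕ → ℕ) : ∀ R : Atom, (R.ren f).ren g = R.ren (g ∘ f)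
  | .const _ => rfl
  | .var _ => rfl
  | .app R N => by simp only [Atom.ren, Atom.ren_ren f g R, Norm.ren_ren f g N]
theorem Norm.ren_ren (f g : ℕ → ℕ) : ∀ N : Norm, (N.ren f).ren g = N.ren (g ∘ f)
  | .atom R => by simp only [Norm.ren, Atom.ren_ren f g R]
  | .lam N => by simp only [Norm.ren, Norm.ren_ren _ _ N, upRen_comp]
end

theorem AtomTy.ren_ren (f g : ℕ → ℕ) (P : AtomTy) : (P.ren f).ren g = P.ren (g ∘ f) := by
  induction P with
  | const => rfl
  | app P N ih => simp only [AtomTy.ren, ih, Norm.ren_ren]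

theorem Ty.ren_ren (f g : ℕ → ℕ) (A : Ty) : (A.ren f).ren g = A.ren (g ∘ f) := by
  induction A generalizing f g with
  | atom P => simp only [Ty.ren, AtomTy.ren_ren]
  | pi A B ihA ihB => simp only [Ty.ren, ihA, ihB, upRen_comp]

theorem AtomSrt.ren_ren (f g : ℕ → ℕ) (Q : AtomSrt) : (Q.ren f).ren g = Q.ren (g ∘ f) := by
  induction Q with
  | const => rfl
  | app Q N ih => simp only [AtomSrt.ren, ih, Norm.ren_ren]

theorem Srt.ren_ren (f g : ℕ → ℕ) (S : Srt) : (S.ren f).ren g = S.ren (g ∘ f) := by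
  induction S generalizing f g with
  | atom Q => simp only [Srt.ren, AtomSrt.ren_ren]
  | pi S A T ihS ihT => simp only [Srt.ren, ihS, ihT, Ty.ren_ren, upRen_comp]
  | top => rfl
  | inter S T ihS ihT => simp only [Srt.ren, ihS, ihT]

mutual
theorem Atom.ren_id : ∀ R : Atom, R.ren id = R
  | .const _ => rfl
  | .var _ => rfl
  | .app R N => by simp only [Atom.ren, Atom.ren_id R, Norm.ren_id N]
theorem Norm.ren_id : ∀ N : Norm, N.ren id = N
  | .atom R => by simp only [Norm.ren, Atom.ren_id R]
  | .lam N => by simp only [Norm.ren, upRen_id, Norm.ren_id N]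
end

theorem AtomTy.ren_id (P : AtomTy) : P.ren id = P := by
  induction P with
  | const => rfl
  | app P N ih => simp only [AtomTy.ren, ih, Norm.ren_id]

theorem Ty.ren_id (A : Ty) : A.ren id = A := by
  induction A with
  | atom P => simp only [Ty.ren, AtomTy.ren_id]
  | pi A B ihA ihB => simp only [Ty.ren, upRen_id, ihA, ihB]

theorem AtomSrt.ren_id (Q : AtomSrt) : Q.ren id = Q := by
  induction Q with
  | const => rfl
  | app Q N ih => simp only [AtomSrt.ren, ih, Norm.ren_id]

theorem Srt.ren_id (S : Srt) : S.ren id = S := by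
  induction S with
  | atom Q => simp only [Srt.ren, AtomSrt.ren_id]
  | pi S A T ihS ihT => simp only [Srt.ren, upRen_id, ihS, ihT, Ty.ren_id]
  | top => rfl
  | inter S T ihS ihT => simp only [Srt.ren, ihS, ihT]

theorem Norm.shift_ren (ξ : ℕ → ℕ) (N : Norm) : (N.ren ξ).shift = N.shift.ren (upRen ξ) := by
  simp only [Norm.shift, Norm.ren_ren]; rfl

theorem AtomTy.erase_ren (ξ : ℕ → ℕ) (P : AtomTy) : (P.ren ξ).erase = P.erase := by
  induction P with
  | const => rfl
  | app _ _ ih => exact ih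

theorem Ty.erase_ren (ξ : ℕ → ℕ) (A : Ty) : (A.ren ξ).erase = A.erase := by
  induction A generalizing ξ with
  | atom P => exact P.erase_ren ξ
  | pi A B ihA ihB => simp only [Ty.ren, Ty.erase, ihA, ihB]

theorem eta_ren (α : STy) (ξ : ℕ → ℕ) (R : Atom) : (eta α R).ren ξ = eta α (R.ren ξ) := by
  induction α generalizing ξ R with
  | base => rfl
  | arr α β ihα ihβ =>
    simp only [eta, Norm.ren, ihβ, Atom.ren, ihα, upRen, Atom.shift, Atom.ren_ren]
    rfl

theorem eta_var_shift (α : STy) (j : ℕ) : (eta α (.var j)).shift = eta α (.var (j + 1)) :=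
  eta_ren _ _ _

/-- The weakening that makes room for a variable with index `k`. -/
def skip (k i : ℕ) : ℕ := if i < k then i else i + 1

theorem skip_zero : skip 0 = Nat.succ := by
  funext i; simp [skip]

theorem upRen_skip (k : ℕ) : upRen (skip k) = skip (k + 1) := by
  funext i
  cases i with
  | zero => simp [upRen, skip]
  | succ i => simp only [upRen, skip]; split_ifs <;> omega

theorem skip_ne (k i : ℕ) : skip k i ≠ k := by
  unfold skip; split_ifs <;> omega

theorem skip_injective (k : ℕ) : Function.Injective (skip k) := by
  intro i j h; unfold skip at h; split_ifs at h <;> omega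

theorem exists_skip_eq {k i : ℕ} (h : i ≠ k) : ∃ j, skip k j = i := by
  rcases lt_or_gt_of_ne h with h | h
  · exact ⟨i, by simp [skip, h]⟩
  · exact ⟨i - 1, by unfold skip; split_ifs <;> omega⟩

/-- The renaming underlying the substitution of the variable `j` for the variable `k`: as in
`HSubN`, the index `k` is removed and `j` is an index of the context without it. -/
def instRen (k j i : ℕ) : ℕ := if i < k then i else if i = k then j else i - 1

theorem upRen_instRen (k j : ℕ) : upRen (instRen k j) = instRen (k + 1) (j + 1) := by
  funext i
  cases i with
  | zero => simp [upRen, instRen]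
  | succ i => simp only [upRen, instRen]; split_ifs <;> omega

theorem instRen_self (k j : ℕ) : instRen k j k = j := by simp [instRen]

theorem instRen_skip (k j i : ℕ) : instRen k j (skip k i) = i := by
  unfold instRen skip; split_ifs <;> omega

theorem instRen_zero_comp_upRen_succ : instRen 0 0 ∘ upRen Nat.succ = id := by
  funext i; cases i <;> rfl

/-! ### Hereditary substitution -/

section HereditarySubstitution

variable {k : ℕ} {N₀ : Norm} {α₀ : STy}

theorem HSubRR.var_iff {i : ℕ} {R' : Atom} :
    HSubRR k N₀ α₀ (.var i) R' ↔ ∃ j, i = skip k j ∧ R' = .var j := by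
  constructor
  · intro h
    cases h with
    | varLt h => exact ⟨i, by simp [skip, h], rfl⟩
    | @varGt _ _ _ i h => exact ⟨i, by simp [skip, h], rfl⟩
  · rintro ⟨j, rfl, rfl⟩
    unfold skip
    split_ifs with h
    · exact .varLt h
    · exact .varGt (by omega)

theorem HSubRR.not_hSubRN :
    ∀ {R R' : Atom} {N : Norm} {α : STy}, HSubRR k N₀ α₀ R R' → ¬ HSubRN k N₀ α₀ R N α
  | .const _, _, _, _, _, h => nomatch h
  | .var i, _, _, _, h, h' => by
    obtain ⟨j, rfl, -⟩ := HSubRR.var_iff.1 h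
    generalize hk : skip k j = i at h'
    cases h'
    exact skip_ne _ _ hk
  | .app _ _, _, _, _, .app h _, .beta h' _ _ => h.not_hSubRN h'

mutual
theorem HSubN.functional : ∀ {k : ℕ} {N₀ : Norm} {α₀ : STy} {N V W : Norm},
    HSubN k N₀ α₀ N V → HSubN k N₀ α₀ N W → V = W
  | _, _, _, _, _, _, .atomNorm h, .atomNorm h' => (h.functional h').1
  | _, _, _, _, _, _, .atomNorm h, .atom h' => absurd h h'.not_hSubRN
  | _, _, _, _, _, _, .atom h, .atomNorm h' => absurd h' h.not_hSubRN
  | _, _, _, _, _, _, .atom h, .atom h' => by rw [h.functional h']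
  | _, _, _, _, _, _, .lam h, .lam h' => by rw [h.functional h']
theorem HSubRR.functional : ∀ {k : ℕ} {N₀ : Norm} {α₀ : STy} {R V W : Atom},
    HSubRR k N₀ α₀ R V → HSubRR k N₀ α₀ R W → V = W
  | _, _, _, _, _, _, .varLt _, .varLt _ => rfl
  | _, _, _, _, _, _, .varGt _, .varGt _ => rfl
  | _, _, _, _, _, _, .varLt h, .varGt h' => by omega
  | _, _, _, _, _, _, .varGt h, .varLt h' => by omega
  | _, _, _, _, _, _, .const, .const => rfl
  | _, _, _, _, _, _, .app h g, .app h' g' => by rw [h.functional h', g.functional g']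
theorem HSubRN.functional : ∀ {k : ℕ} {N₀ : Norm} {α₀ : STy} {R : Atom} {V W : Norm} {α β : STy},
    HSubRN k N₀ α₀ R V α → HSubRN k N₀ α₀ R W β → V = W ∧ α = β
  | _, _, _, _, _, _, _, _, .var, .var => ⟨rfl, rfl⟩
  | _, _, _, _, _, _, _, _, .beta h₁ h₂ h₃, .beta h₁' h₂' h₃' => by
    obtain ⟨e, e'⟩ := h₁.functional h₁'
    cases e; cases e'
    cases h₂.functional h₂'
    exact ⟨h₃.functional h₃', rfl⟩
end

theorem HSubP.functional {P V W : AtomTy} (h : HSubP k N₀ α₀ P V) (h' : HSubP k N₀ α₀ P W) :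
    V = W := by
  induction h generalizing W with
  | const => cases h'; rfl
  | app _ g ih => cases h' with | app h' g' => rw [ih h', g.functional g']

theorem HSubA.functional {A V W : Ty} (h : HSubA k N₀ α₀ A V) (h' : HSubA k N₀ α₀ A W) :
    V = W := by
  induction h generalizing W with
  | atom h => cases h' with | atom h' => rw [h.functional h']
  | pi _ _ ih₁ ih₂ => cases h' with | pi h₁ h₂ => rw [ih₁ h₁, ih₂ h₂]

theorem HSubQ.functional {Q V W : AtomSrt} (h : HSubQ k N₀ α₀ Q V) (h' : HSubQ k N₀ α₀ Q W) :
    V = W := by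
  induction h generalizing W with
  | const => cases h'; rfl
  | app _ g ih => cases h' with | app h' g' => rw [ih h', g.functional g']

theorem HSubP.erase_eq {P P' : AtomTy} (h : HSubP k N₀ α₀ P P') : P'.erase = P.erase := by
  induction h with
  | const => rfl
  | app _ _ ih => exact ih

theorem HSubA.erase_eq {A A' : Ty} (h : HSubA k N₀ α₀ A A') : A'.erase = A.erase := by
  induction h with
  | atom h => exact h.erase_eq
  | pi _ _ ih₁ ih₂ => simp only [Ty.erase, ih₁, ih₂]

theorem HSubRN.sizeOf_le : ∀ {R : Atom} {M : Norm} {β : STy},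
    HSubRN k N₀ α₀ R M β → sizeOf β ≤ sizeOf α₀
  | .var _, _, _, .var => le_rfl
  | .app _ _, _, _, .beta h _ _ => by
    have := h.sizeOf_le
    simp only [STy.arr.sizeOf_spec] at this
    omega

theorem HSubRN.sizeOf_lt_of_arr {R : Atom} {M : Norm} {β γ : STy}
    (h : HSubRN k N₀ α₀ R M (.arr β γ)) : sizeOf β < sizeOf α₀ := by
  have := h.sizeOf_le
  simp only [STy.arr.sizeOf_spec] at this
  omega

mutual
theorem HSubRR.ren_skip (α₀ : STy) : ∀ (k : ℕ) (N₀ : Norm) (R : Atom),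
    HSubRR k N₀ α₀ (R.ren (skip k)) R
  | _, _, .const _ => .const
  | _, _, .var i => HSubRR.var_iff.2 ⟨i, rfl, rfl⟩
  | _, _, .app R N => .app (HSubRR.ren_skip α₀ _ _ R) (HSubN.ren_skip α₀ _ _ N)
theorem HSubN.ren_skip (α₀ : STy) : ∀ (k : ℕ) (N₀ N : Norm), HSubN k N₀ α₀ (N.ren (skip k)) N
  | _, _, .atom R => .atom (HSubRR.ren_skip α₀ _ _ R)
  | _, _, .lam N => .lam (by rw [upRen_skip]; exact HSubN.ren_skip α₀ _ _ N)
end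

theorem HSubRR.shift (α₀ : STy) (N₀ : Norm) (R : Atom) : HSubRR 0 N₀ α₀ R.shift R := by
  have := HSubRR.ren_skip α₀ 0 N₀ R
  rwa [skip_zero] at this

end HereditarySubstitution

/-! ### Hereditary substitution reflects renamings -/

/-- `ξ` and `ξ'` are the actions of one renaming without and with the substituted variable,
which has index `k` before and `k'` after the renaming. -/
structure SubstRen (k : ℕ) (ξ : ℕ → ℕ) (k' : ℕ) (ξ' : ℕ → ℕ) : Prop where
  self : ξ' k = k'
  skip : ∀ i, ξ' (skip k i) = LFR.skip k' (ξ i)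

theorem SubstRen.up {k k' : ℕ} {ξ ξ' : ℕ → ℕ} (h : SubstRen k ξ k' ξ') :
    SubstRen (k + 1) (upRen ξ) (k' + 1) (upRen ξ') where
  self := by simp [upRen, h.self]
  skip i := by
    rw [← upRen_skip, ← upRen_skip]
    cases i with
    | zero => rfl
    | succ i => simp [upRen, h.skip]

theorem SubstRen.zero (ξ : ℕ → ℕ) : SubstRen 0 ξ 0 (upRen ξ) where
  self := rfl
  skip i := by rw [skip_zero]; rfl

theorem SubstRen.succ (k : ℕ) : SubstRen k Nat.succ (k + 1) Nat.succ where
  self := rfl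
  skip i := by rw [← upRen_skip]; rfl

theorem SubstRen.exists_skip_eq {k k' i j : ℕ} {ξ ξ' : ℕ → ℕ} (h : SubstRen k ξ k' ξ')
    (hij : ξ' i = LFR.skip k' j) : ∃ l, i = LFR.skip k l ∧ j = ξ l := by
  have hi : i ≠ k := by
    rintro rfl
    exact skip_ne _ _ (hij.symm.trans h.self)
  obtain ⟨l, rfl⟩ := LFR.exists_skip_eq hi
  exact ⟨l, rfl, skip_injective _ (hij.symm.trans (h.skip l))⟩

theorem SubstRen.eq_of_apply_eq {k k' i : ℕ} {ξ ξ' : ℕ → ℕ} (h : SubstRen k ξ k' ξ')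
    (hi : ξ' i = k') : i = k := by
  by_contra hne
  obtain ⟨j, rfl⟩ := LFR.exists_skip_eq hne
  exact skip_ne _ _ ((h.skip j).symm.trans hi)

theorem HSubRR.reflect_ren_var {k k' i : ℕ} {ξ ξ' : ℕ → ℕ} {N₀ N₀' : Norm} {α₀ : STy} {V' : Atom}
    (hξ : SubstRen k ξ k' ξ') (h : HSubRR k' N₀' α₀ (.var (ξ' i)) V') :
    ∃ V, V' = V.ren ξ ∧ HSubRR k N₀ α₀ (.var i) V := by
  obtain ⟨j, hj, rfl⟩ := HSubRR.var_iff.1 h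
  obtain ⟨l, rfl, rfl⟩ := hξ.exists_skip_eq hj
  exact ⟨.var l, rfl, HSubRR.var_iff.2 ⟨l, rfl, rfl⟩⟩

mutual
theorem HSubN.reflect_ren : ∀ {k' : ℕ} {N₀' : Norm} {α₀ : STy} {N' V' : Norm},
    HSubN k' N₀' α₀ N' V' → ∀ {k : ℕ} {ξ ξ' : ℕ → ℕ} {N₀ N : Norm}, SubstRen k ξ k' ξ' →
    N₀' = N₀.ren ξ → N' = N.ren ξ' → ∃ V, V' = V.ren ξ ∧ HSubN k N₀ α₀ N V
  | _, _, _, _, _, .atomNorm h, _, _, _, _, .atom R, hξ, e₀, e => by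
    obtain ⟨V, hV, h⟩ := h.reflect_ren hξ e₀ (Norm.atom.inj e)
    cases V with
    | atom V => exact ⟨_, hV, .atomNorm h⟩
    | lam => cases hV
  | _, _, _, _, _, .atom h, _, _, _, _, .atom R, hξ, e₀, e => by
    obtain ⟨V, hV, h⟩ := h.reflect_ren hξ e₀ (Norm.atom.inj e)
    exact ⟨.atom V, by rw [hV]; rfl, .atom h⟩
  | _, _, _, _, _, .lam h, _, _, _, _, .lam N, hξ, e₀, e => by
    obtain ⟨V, hV, h⟩ := h.reflect_ren hξ.up (by rw [e₀, Norm.shift_ren]) (Norm.lam.inj e)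
    exact ⟨.lam V, by rw [hV]; rfl, .lam h⟩
theorem HSubRR.reflect_ren : ∀ {k' : ℕ} {N₀' : Norm} {α₀ : STy} {R' V' : Atom},
    HSubRR k' N₀' α₀ R' V' → ∀ {k : ℕ} {ξ ξ' : ℕ → ℕ} {N₀ : Norm} {R : Atom},
    SubstRen k ξ k' ξ' →
    N₀' = N₀.ren ξ → R' = R.ren ξ' → ∃ V, V' = V.ren ξ ∧ HSubRR k N₀ α₀ R V
  | _, _, _, _, _, .const, _, _, _, _, .const _, _, _, e => by
    cases e; exact ⟨_, rfl, .const⟩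
  | _, _, _, _, _, .app h g, _, _, _, _, .app R N, hξ, e₀, e => by
    obtain ⟨V, hV, h⟩ := h.reflect_ren hξ e₀ (Atom.app.inj e).1
    obtain ⟨W, hW, g⟩ := g.reflect_ren hξ e₀ (Atom.app.inj e).2
    exact ⟨.app V W, by rw [hV, hW]; rfl, .app h g⟩
  | _, _, _, _, _, h, _, _, _, _, .var _, hξ, _, e => by
    subst e
    exact HSubRR.reflect_ren_var hξ h
theorem HSubRN.reflect_ren : ∀ {k' : ℕ} {N₀' : Norm} {α₀ : STy} {R' : Atom} {V' : Norm}
    {α : STy}, HSubRN k' N₀' α₀ R' V' α →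
    ∀ {k : ℕ} {ξ ξ' : ℕ → ℕ} {N₀ : Norm} {R : Atom}, SubstRen k ξ k' ξ' →
    N₀' = N₀.ren ξ → R' = R.ren ξ' → ∃ V, V' = V.ren ξ ∧ HSubRN k N₀ α₀ R V α
  | _, _, _, _, _, _, .var, _, _, _, _, .var _, hξ, e₀, e => by
    obtain rfl := hξ.eq_of_apply_eq (Atom.var.inj e).symm
    exact ⟨_, e₀, .var⟩
  | _, _, _, _, _, _, .beta h₁ h₂ h₃, _, _, _, _, .app R N, hξ, e₀, e => by
    obtain ⟨V, hV, h₁⟩ := h₁.reflect_ren hξ e₀ (Atom.app.inj e).1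
    obtain ⟨W, hW, h₂⟩ := h₂.reflect_ren hξ e₀ (Atom.app.inj e).2
    cases V with
    | atom => cases hV
    | lam V =>
      obtain ⟨U, hU, h₃⟩ := h₃.reflect_ren (SubstRen.zero _) hW (Norm.lam.inj hV)
      exact ⟨U, hU, .beta h₁ h₂ h₃⟩
end

/-! ### Substitution of an η-expanded variable -/

theorem HSubN.eta_cases {γ : STy} : ∀ {k : ℕ} {N₀ : Norm} {α₀ : STy} {R : Atom} {V : Norm},
    HSubN k N₀ α₀ (eta γ R) V →
    (∃ M β, HSubRN k N₀ α₀ R M β) ∨ ∃ R', HSubRR k N₀ α₀ R R' ∧ V = eta γ R' := by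
  induction γ with
  | base a =>
    intro k N₀ α₀ R V h
    cases h with
    | atomNorm h => exact .inl ⟨_, _, h⟩
    | atom h => exact .inr ⟨_, h, rfl⟩
  | arr γ₁ γ₂ ih₁ ih₂ =>
    intro k N₀ α₀ R V h
    obtain _ | _ | h := h
    rcases ih₂ h with ⟨M, β, _ | ⟨h₁, _, _⟩⟩ | ⟨_, _ | _ | _ | ⟨hR, hη⟩, rfl⟩
    · obtain ⟨M, -, h₁⟩ := h₁.reflect_ren (SubstRen.succ k) rfl rfl
      exact .inl ⟨_, _, h₁⟩
    · obtain ⟨R', rfl, hR'⟩ := hR.reflect_ren (SubstRen.succ k) rfl rfl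
      refine .inr ⟨R', hR', ?_⟩
      rcases ih₁ hη with ⟨_, _, h₀⟩ | ⟨_, h₀, rfl⟩ <;> cases h₀
      rfl

theorem HSubN.eta_eq_of_hSubRR {k : ℕ} {N₀ V : Norm} {α₀ γ : STy} {R R' : Atom}
    (h : HSubN k N₀ α₀ (eta γ R) V) (hR : HSubRR k N₀ α₀ R R') : V = eta γ R' := by
  rcases h.eta_cases with ⟨_, _, h'⟩ | ⟨_, h', rfl⟩
  · exact absurd h' hR.not_hSubRN
  · rw [h'.functional hR]

/-- Where it is defined, the substitution `[η_α(y)/x]_α` renames `x` to `y`. -/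
def EtaSubstRen (α : STy) : Prop :=
  ∀ {k j : ℕ} {N V : Norm}, HSubN k (eta α (.var j)) α N V → V = N.ren (instRen k j)

theorem HSubN.eta_eq_of_hSubRN {α₀ : STy}
    (hα₀ : ∀ γ : STy, sizeOf γ < sizeOf α₀ → EtaSubstRen γ) {γ : STy} :
    ∀ {k : ℕ} {N₀ : Norm} {R : Atom} {M V : Norm},
      HSubN k N₀ α₀ (eta γ R) V → HSubRN k N₀ α₀ R M γ → V = M := by
  induction γ with
  | base a =>
    intro k N₀ R M V h hR
    cases h with
    | atomNorm h => exact (h.functional hR).1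
    | atom h => exact absurd hR h.not_hSubRN
  | arr γ₁ γ₂ _ ih₂ =>
    intro k N₀ R M V h hR
    obtain _ | _ | h := h
    rcases h.eta_cases with ⟨M', β, h'⟩ | ⟨_, _ | _ | _ | ⟨h₁, _⟩, -⟩
    · have hβ := h'
      obtain _ | ⟨h₁, h₂, h₃⟩ := h'
      obtain ⟨M₀, hM₀, h₁⟩ := h₁.reflect_ren (SubstRen.succ k) rfl rfl
      obtain ⟨rfl, hγ⟩ := h₁.functional hR
      cases hγ
      obtain _ | m := M₀ <;> cases hM₀
      obtain rfl := h₂.eta_eq_of_hSubRR (.varLt (Nat.succ_pos k))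
      have hm := hα₀ γ₁ hR.sizeOf_lt_of_arr h₃
      rw [Norm.ren_ren, instRen_zero_comp_upRen_succ, Norm.ren_id] at hm
      rw [ih₂ h hβ, hm]
    · obtain ⟨_, -, h₁⟩ := h₁.reflect_ren (SubstRen.succ k) rfl rfl
      exact absurd hR h₁.not_hSubRN

mutual
theorem HSubN.eq_ren_of_forall_lt {α : STy}
    (hα : ∀ γ : STy, sizeOf γ < sizeOf α → EtaSubstRen γ) :
    ∀ {k j : ℕ} (N : Norm) {N₀ V : Norm},
    N₀ = eta α (.var j) → HSubN k N₀ α N V → V = N.ren (instRen k j)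
  | _, _, .atom R, _, _, e, .atomNorm h => HSubRN.eq_eta_ren_of_forall_lt hα R e h
  | _, _, .atom R, _, _, e, .atom h => congrArg _ (HSubRR.eq_ren_of_forall_lt hα R e h)
  | _, _, .lam N, _, _, e, .lam h => by
    rw [Norm.ren, upRen_instRen, HSubN.eq_ren_of_forall_lt hα N (by rw [e, eta_var_shift]) h]
theorem HSubRR.eq_ren_of_forall_lt {α : STy}
    (hα : ∀ γ : STy, sizeOf γ < sizeOf α → EtaSubstRen γ) :
    ∀ {k j : ℕ} (R : Atom) {N₀ : Norm} {R' : Atom},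
    N₀ = eta α (.var j) → HSubRR k N₀ α R R' → R' = R.ren (instRen k j)
  | _, _, .const _, _, _, _, .const => rfl
  | _, _, .var _, _, _, _, h => by
    obtain ⟨i, rfl, rfl⟩ := HSubRR.var_iff.1 h
    rw [Atom.ren, instRen_skip]
  | _, _, .app R N, _, _, e, .app h g => by
    rw [Atom.ren, HSubRR.eq_ren_of_forall_lt hα R e h, HSubN.eq_ren_of_forall_lt hα N e g]
theorem HSubRN.eq_eta_ren_of_forall_lt {α : STy}
    (hα : ∀ γ : STy, sizeOf γ < sizeOf α → EtaSubstRen γ) :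
    ∀ {k j : ℕ} (R : Atom) {N₀ M : Norm} {β : STy}, N₀ = eta α (.var j) →
      HSubRN k N₀ α R M β → M = eta β (R.ren (instRen k j))
  | _, _, .var _, _, _, _, e, .var => by rw [Atom.ren, instRen_self, e]
  | _, _, .app R N, _, _, _, e, .beta h₁ h₂ h₃ => by
    have hR := HSubRN.eq_eta_ren_of_forall_lt hα R e h₁
    obtain rfl := HSubN.eq_ren_of_forall_lt hα N e h₂
    rw [eta] at hR
    cases hR
    rcases h₃.eta_cases with ⟨_, _, _ | ⟨h, _, _⟩⟩ | ⟨_, _ | _ | _ | ⟨h, hη⟩, rfl⟩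
    · exact absurd h (HSubRR.shift _ _ _).not_hSubRN
    · obtain rfl := h.functional (HSubRR.shift _ _ _)
      have hlt := h₁.sizeOf_lt_of_arr
      rw [hη.eta_eq_of_hSubRN (fun γ hγ => hα γ (hγ.trans hlt)) .var, Atom.ren]
end

theorem etaSubstRen (α : STy) : EtaSubstRen α := by
  induction h : sizeOf α using Nat.strong_induction_on generalizing α with
  | _ n ih =>
    subst h
    exact fun h => HSubN.eq_ren_of_forall_lt (fun γ hγ => ih _ hγ γ rfl) _ rfl h

theorem HSubP.eta_var {α : STy} {k j : ℕ} {P V : AtomTy}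
    (h : HSubP k (eta α (.var j)) α P V) : V = P.ren (instRen k j) := by
  induction h with
  | const => rfl
  | app _ g ih => rw [AtomTy.ren, ih, etaSubstRen α g]

theorem HSubA.eta_var {α : STy} : ∀ {k j : ℕ} {A V : Ty},
    HSubA k (eta α (.var j)) α A V → V = A.ren (instRen k j)
  | _, _, .atom _, _, .atom h => by rw [h.eta_var, Ty.ren]
  | _, _, .pi _ _, _, .pi h₁ h₂ => by
    rw [eta_var_shift] at h₂
    rw [h₁.eta_var, h₂.eta_var, Ty.ren, upRen_instRen]

theorem HSubQ.eta_var {α : STy} {k j : ℕ} {Q V : AtomSrt}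
    (h : HSubQ k (eta α (.var j)) α Q V) : V = Q.ren (instRen k j) := by
  induction h with
  | const => rfl
  | app _ g ih => rw [AtomSrt.ren, ih, etaSubstRen α g]

theorem HSubS.eta_var {α : STy} : ∀ {k j : ℕ} {S V : Srt},
    HSubS k (eta α (.var j)) α S V → V = S.ren (instRen k j)
  | _, _, .atom _, _, .atom h => by rw [h.eta_var, Srt.ren]
  | _, _, .pi _ _ _, _, .pi h₁ g h₂ => by
    rw [eta_var_shift] at h₂
    rw [h₁.eta_var, g.eta_var, h₂.eta_var, Srt.ren, upRen_instRen]
  | _, _, .top, _, .top => rfl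
  | _, _, .inter _ _, _, .inter h₁ h₂ => by rw [h₁.eta_var, h₂.eta_var, Srt.ren]

/-! ### Context-free refinement -/

/-- `Q` and `P` are constants applied to literally the same arguments. -/
inductive AtomPreRefines : AtomSrt → AtomTy → Prop
  | const (s a : ℕ) : AtomPreRefines (.const s) (.const a)
  | app {Q : AtomSrt} {P : AtomTy} (N : Norm) :
      AtomPreRefines Q P → AtomPreRefines (.app Q N) (.app P N)

/-- Refinement without signature and context: only the shape of `S` and the arguments of its
atomic sorts are compared with `A`.  It is what remains stable under arbitrary substitutions. -/
inductive PreRefines : Srt → Ty → Prop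
  | atom {Q : AtomSrt} {P : AtomTy} : AtomPreRefines Q P → PreRefines (.atom Q) (.atom P)
  | pi {S T : Srt} {A B : Ty} :
      PreRefines S A → PreRefines T B → PreRefines (.pi S A T) (.pi A B)
  | top {A : Ty} : PreRefines .top A
  | inter {S₁ S₂ : Srt} {A : Ty} :
      PreRefines S₁ A → PreRefines S₂ A → PreRefines (.inter S₁ S₂) A

/-- Context-free refinement of kinds by classes. -/
inductive ClsPreRefines : Cls → Knd → Prop
  | sort : ClsPreRefines .sort .type
  | pi {S : Srt} {A : Ty} {L : Cls} {K : Knd} :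
      PreRefines S A → ClsPreRefines L K → ClsPreRefines (.pi S A L) (.pi A K)
  | top {K : Knd} : ClsPreRefines .top K
  | inter {L₁ L₂ : Cls} {K : Knd} :
      ClsPreRefines L₁ K → ClsPreRefines L₂ K → ClsPreRefines (.inter L₁ L₂) K

theorem AtomPreRefines.ren (ξ : ℕ → ℕ) {Q : AtomSrt} {P : AtomTy} (h : AtomPreRefines Q P) :
    AtomPreRefines (Q.ren ξ) (P.ren ξ) := by
  induction h with
  | const s a => exact .const s a
  | app N _ ih => exact .app _ ih

theorem PreRefines.ren {S : Srt} {A : Ty} (h : PreRefines S A) (ξ : ℕ → ℕ) :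
    PreRefines (S.ren ξ) (A.ren ξ) := by
  induction h generalizing ξ with
  | atom h => exact .atom (h.ren ξ)
  | pi _ _ ihS ihT => exact .pi (ihS ξ) (ihT _)
  | top => exact .top
  | inter _ _ ih₁ ih₂ => exact .inter (ih₁ ξ) (ih₂ ξ)

section PreRefinesSubstitution

variable {k : ℕ} {N₀ : Norm} {α₀ : STy}

theorem AtomPreRefines.exists_hSubQ {Q : AtomSrt} {P P' : AtomTy} (h : AtomPreRefines Q P)
    (hP : HSubP k N₀ α₀ P P') : ∃ Q', HSubQ k N₀ α₀ Q Q' := by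
  induction h generalizing P' with
  | const s => exact ⟨.const s, .const⟩
  | app N _ ih =>
    obtain _ | ⟨hP, hN⟩ := hP
    obtain ⟨Q', hQ⟩ := ih hP
    exact ⟨_, .app hQ hN⟩

theorem PreRefines.exists_hSubS {S : Srt} {A A' : Ty} (h : PreRefines S A)
    (hA : HSubA k N₀ α₀ A A') : ∃ S', HSubS k N₀ α₀ S S' := by
  induction h generalizing k N₀ A' with
  | atom h =>
    obtain hP | _ := hA
    obtain ⟨Q', hQ⟩ := h.exists_hSubQ hP
    exact ⟨_, .atom hQ⟩
  | pi _ _ ihS ihT =>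
    obtain _ | ⟨hA, hB⟩ := hA
    obtain ⟨S', hS⟩ := ihS hA
    obtain ⟨T', hT⟩ := ihT hB
    exact ⟨_, .pi hS hA hT⟩
  | top => exact ⟨_, .top⟩
  | inter _ _ ih₁ ih₂ =>
    obtain ⟨S₁', h₁⟩ := ih₁ hA
    obtain ⟨S₂', h₂⟩ := ih₂ hA
    exact ⟨_, .inter h₁ h₂⟩

theorem AtomPreRefines.hSub {Q Q' : AtomSrt} {P P' : AtomTy} (h : AtomPreRefines Q P)
    (hQ : HSubQ k N₀ α₀ Q Q') (hP : HSubP k N₀ α₀ P P') : AtomPreRefines Q' P' := by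
  induction h generalizing Q' P' with
  | const s a => cases hQ; cases hP; exact .const s a
  | app N _ ih =>
    obtain _ | ⟨hQ, hN⟩ := hQ
    obtain _ | ⟨hP, hN'⟩ := hP
    obtain rfl := hN.functional hN'
    exact .app _ (ih hQ hP)

theorem PreRefines.hSub {S S' : Srt} {A A' : Ty} (h : PreRefines S A)
    (hS : HSubS k N₀ α₀ S S') (hA : HSubA k N₀ α₀ A A') : PreRefines S' A' := by
  induction h generalizing k N₀ S' A' with
  | atom h =>
    cases hS with | atom hQ => cases hA with | atom hP => exact .atom (h.hSub hQ hP)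
  | pi _ _ ihS ihT =>
    cases hS with | pi hS hA₁ hT => cases hA with | pi hA₂ hB =>
      obtain rfl := hA₁.functional hA₂
      exact .pi (ihS hS hA₁) (ihT hT hB)
  | top => cases hS; exact .top
  | inter _ _ ih₁ ih₂ => cases hS with | inter h₁ h₂ => exact .inter (ih₁ h₁ hA) (ih₂ h₂ hA)

theorem ClsPreRefines.hSub {L L' : Cls} {K K' : Knd} (h : ClsPreRefines L K)
    (hL : HSubL k N₀ α₀ L L') (hK : HSubK k N₀ α₀ K K') : ClsPreRefines L' K' := by
  induction h generalizing k N₀ L' K' with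
  | sort => cases hL; cases hK; exact .sort
  | pi hS _ ih =>
    cases hL with | pi hS' hA₁ hL => cases hK with | pi hA₂ hK =>
      obtain rfl := hA₁.functional hA₂
      exact .pi (hS.hSub hS' hA₁) (ih hL hK)
  | top => cases hL; exact .top
  | inter _ _ ih₁ ih₂ => cases hL with | inter h₁ h₂ => exact .inter (ih₁ h₁ hK) (ih₂ h₂ hK)

end PreRefinesSubstitution

section Signature

variable {Sg : Sig}

theorem ClsSynth.atomPreRefines {Γ : Ctx} {Q : AtomSrt} {P : AtomTy} {L : Cls}
    (h : ClsSynth Sg Γ Q P L) : AtomPreRefines Q P := by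
  induction h with
  | const => exact .const _ _
  | app _ _ _ ih => exact .app _ ih
  | interE₁ _ ih => exact ih
  | interE₂ _ ih => exact ih

theorem Refines.preRefines {Γ : Ctx} {S : Srt} {A : Ty} (h : Refines Sg Γ S A) :
    PreRefines S A := by
  induction h with
  | atom h => exact .atom h.atomPreRefines
  | pi _ _ ihS ihT => exact .pi ihS ihT
  | top => exact .top
  | inter _ _ ih₁ ih₂ => exact .inter ih₁ ih₂

theorem ClsRefines.clsPreRefines {Γ : Ctx} {L : Cls} {K : Knd} (h : ClsRefines Sg Γ L K) :
    ClsPreRefines L K := by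
  induction h with
  | sort => exact .sort
  | pi hS _ ih => exact .pi hS.preRefines ih
  | top => exact .top
  | inter _ _ ih₁ ih₂ => exact .inter ih₁ ih₂

theorem SigOK.tmConst_unique (h : SigOK Sg) {c : ℕ} {A B : Ty} (hA : Decl.tmConst c A ∈ Sg)
    (hB : Decl.tmConst c B ∈ Sg) : A = B := by
  induction h <;> grind

theorem SigOK.tyConst_unique (h : SigOK Sg) {a : ℕ} {K₁ K₂ : Knd}
    (h₁ : Decl.tyConst a K₁ ∈ Sg) (h₂ : Decl.tyConst a K₂ ∈ Sg) : K₁ = K₂ := by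
  induction h <;> grind

theorem SigOK.exists_tmConst (h : SigOK Sg) {c : ℕ} {S : Srt} (hS : Decl.tmSrt c S ∈ Sg) :
    ∃ A, Decl.tmConst c A ∈ Sg ∧ PreRefines S A := by
  induction h <;> grind [Refines.preRefines]

theorem SigOK.exists_tyConst (h : SigOK Sg) {s a : ℕ} {L : Cls}
    (hL : Decl.srtConst s a L ∈ Sg) : ∃ K, Decl.tyConst a K ∈ Sg ∧ ClsPreRefines L K := by
  induction h <;> grind [ClsRefines.clsPreRefines]

theorem CtxOK.preRefines {Γ : Ctx} (hΓ : CtxOK Sg Γ) : ∀ d ∈ Γ, PreRefines d.1 d.2 := by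
  induction hΓ with
  | nil => simp
  | cons _ _ hS ih => exact List.forall_mem_cons.2 ⟨hS.preRefines, ih⟩

theorem Lookup.preRefines {Γ : Ctx} {i : ℕ} {S : Srt} {A : Ty}
    (hΓ : ∀ d ∈ Γ, PreRefines d.1 d.2) (hS : Lookup Γ i S) (hA : LookupTy Γ.erase i A) :
    PreRefines S A := by
  induction hS generalizing A with
  | zero Γ S A => cases hA; exact (hΓ _ List.mem_cons_self).ren _
  | succ d _ ih =>
    obtain _ | ⟨_, hA⟩ := hA
    exact (ih (fun d hd => hΓ d (List.mem_cons_of_mem _ hd)) hA).ren _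

theorem SortSynth.preRefines {Γ : Ctx} (hSg : SigOK Sg) (hΓ : ∀ d ∈ Γ, PreRefines d.1 d.2) :
    ∀ {R : Atom} {S : Srt} {A : Ty},
      SortSynth Sg Γ R S → TmSynth Sg Γ.erase R A → PreRefines S A
  | _, _, _, .const hS, .const hA => by
    obtain ⟨B, hB, h⟩ := hSg.exists_tmConst hS
    rwa [hSg.tmConst_unique hA hB]
  | _, _, _, .var hS, .var hA => hS.preRefines hΓ hA
  | _, _, _, .app hR _ hT, .app hR' _ hB => by
    obtain _ | ⟨_, h⟩ := hR.preRefines hSg hΓ hR'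
    exact h.hSub hT hB
  | _, _, _, .interE₁ h, hA => by
    obtain _ | _ | _ | ⟨h, _⟩ := h.preRefines hSg hΓ hA
    exact h
  | _, _, _, .interE₂ h, hA => by
    obtain _ | _ | _ | ⟨_, h⟩ := h.preRefines hSg hΓ hA
    exact h

theorem ClsSynth.clsPreRefines {Γ : Ctx} {Δ : List Ty} (hSg : SigOK Sg) :
    ∀ {Q : AtomSrt} {P : AtomTy} {L : Cls} {K : Knd},
      ClsSynth Sg Γ Q P L → TySynth Sg Δ P K → ClsPreRefines L K
  | _, _, _, _, .const hL, .const hK => by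
    obtain ⟨K', hK', h⟩ := hSg.exists_tyConst hL
    rwa [hSg.tyConst_unique hK hK']
  | _, _, _, _, .app hQ _ hL, .app hP _ hK => by
    obtain _ | ⟨_, h⟩ := hQ.clsPreRefines hSg hP
    exact h.hSub hL hK
  | _, _, _, _, .interE₁ h, hP => by
    obtain _ | _ | _ | ⟨h, _⟩ := h.clsPreRefines hSg hP
    exact h
  | _, _, _, _, .interE₂ h, hP => by
    obtain _ | _ | _ | ⟨_, h⟩ := h.clsPreRefines hSg hP
    exact h

end Signature

/-! ### Conjuncts -/

/-- `V` is obtained from the sort `S` by discarding conjuncts. -/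
inductive HasConjunct : Srt → Srt → Prop
  | refl (S : Srt) : HasConjunct S S
  | left {S₁ S₂ V : Srt} : HasConjunct S₁ V → HasConjunct (.inter S₁ S₂) V
  | right {S₁ S₂ V : Srt} : HasConjunct S₂ V → HasConjunct (.inter S₁ S₂) V

theorem HasConjunct.trans {S V W : Srt} (h : HasConjunct S V) (h' : HasConjunct V W) :
    HasConjunct S W := by
  induction h with
  | refl => exact h'
  | left _ ih => exact .left (ih h')
  | right _ ih => exact .right (ih h')

theorem HasConjunct.of_ren {ξ : ℕ → ℕ} {S W : Srt} (h : HasConjunct (S.ren ξ) W) :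
    ∃ V, HasConjunct S V ∧ W = V.ren ξ := by
  induction S with
  | inter S₁ S₂ ih₁ ih₂ =>
    obtain _ | h | h := h
    · exact ⟨_, .refl _, rfl⟩
    · obtain ⟨V, hV, rfl⟩ := ih₁ h
      exact ⟨V, .left hV, rfl⟩
    · obtain ⟨V, hV, rfl⟩ := ih₂ h
      exact ⟨V, .right hV, rfl⟩
  | _ => cases h; exact ⟨_, .refl _, rfl⟩

theorem HasConjunct.transport {p : Srt → Prop} {S V : Srt} (h : HasConjunct S V)
    (hp : ∀ S₁ S₂, p (.inter S₁ S₂) → p S₁ ∧ p S₂) (hS : p S) : p V := by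
  induction h with
  | refl => exact hS
  | left _ ih => exact ih (hp _ _ hS).1
  | right _ ih => exact ih (hp _ _ hS).2

theorem PreRefines.of_hasConjunct {S V : Srt} {A : Ty} (hS : PreRefines S A)
    (h : HasConjunct S V) : PreRefines V A :=
  h.transport (p := (PreRefines · A))
    (fun _ _ h => by cases h with | inter h₁ h₂ => exact ⟨h₁, h₂⟩) hS

section Synthesis

variable {Sg : Sig} {Γ : Ctx}

theorem SortSynth.of_hasConjunct {R : Atom} {S V : Srt} (hS : SortSynth Sg Γ R S)
    (h : HasConjunct S V) : SortSynth Sg Γ R V :=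
  h.transport (p := SortSynth Sg Γ R) (fun _ _ h => ⟨.interE₁ h, .interE₂ h⟩) hS

theorem sortCheck_inter_iff {N : Norm} {S₁ S₂ : Srt} :
    SortCheck Sg Γ N (.inter S₁ S₂) ↔ SortCheck Sg Γ N S₁ ∧ SortCheck Sg Γ N S₂ :=
  ⟨fun h => by cases h with | inter h₁ h₂ => exact ⟨h₁, h₂⟩, fun h => .inter h.1 h.2⟩

/-- Sort synthesis that does not end with an elimination of an intersection. -/
inductive DirectSynth (Sg : Sig) (Γ : Ctx) : Atom → Srt → Prop
  | const {c : ℕ} {S : Srt} : Decl.tmSrt c S ∈ Sg → DirectSynth Sg Γ (.const c) S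
  | var {i : ℕ} {S : Srt} : Lookup Γ i S → DirectSynth Sg Γ (.var i) S
  | app {R : Atom} {N : Norm} {S T T' : Srt} {A : Ty} :
      SortSynth Sg Γ R (.pi S A T) → SortCheck Sg Γ N S → HSubS 0 N A.erase T T' →
      DirectSynth Sg Γ (.app R N) T'

theorem SortSynth.exists_directSynth : ∀ {R : Atom} {V : Srt}, SortSynth Sg Γ R V →
    ∃ S, DirectSynth Sg Γ R S ∧ HasConjunct S V
  | _, _, .const h => ⟨_, .const h, .refl _⟩
  | _, _, .var h => ⟨_, .var h, .refl _⟩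
  | _, _, .app hR hN hT => ⟨_, .app hR hN hT, .refl _⟩
  | _, _, .interE₁ h =>
    have ⟨S, hS, hV⟩ := h.exists_directSynth
    ⟨S, hS, hV.trans (.left (.refl _))⟩
  | _, _, .interE₂ h =>
    have ⟨S, hS, hV⟩ := h.exists_directSynth
    ⟨S, hS, hV.trans (.right (.refl _))⟩

end Synthesis

/-! ### Algorithmic subsorting -/

/-- The codomains of those function sorts among the conjuncts of `Δ` whose domain satisfies `p`. -/
def codomains (Δ : Set Srt) (p : Srt → Prop) : Set Srt :=
  {T | ∃ V ∈ Δ, ∃ S A, HasConjunct V (.pi S A T) ∧ p S}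

/-- `AlgSub Sg α Δ T`: the intersection of the sorts in `Δ`, which refine types with erasure `α`,
is a subsort of `T`.  This syntax-directed relation does not mention contexts. -/
def AlgSub (Sg : Sig) : STy → Set Srt → Srt → Prop
  | _, _, .top => True
  | α, Δ, .inter T₁ T₂ => AlgSub Sg α Δ T₁ ∧ AlgSub Sg α Δ T₂
  | _, Δ, .atom Q => ∃ V ∈ Δ, ∃ Q', HasConjunct V (.atom Q') ∧ AtomSub Sg Q' Q
  | .base _, _, .pi _ _ _ => False
  | .arr α β, Δ, .pi U _ T => AlgSub Sg β (codomains Δ (AlgSub Sg α {U})) T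
termination_by α _ T => (α, T)

section AlgorithmicSubsorting

variable {Sg : Sig}

theorem AtomSub.trans {Q₁ Q₂ Q₃ : AtomSrt} (h : AtomSub Sg Q₁ Q₂) (h' : AtomSub Sg Q₂ Q₃) :
    AtomSub Sg Q₁ Q₃ := by
  induction h with
  | refl => exact h'
  | step h _ ih => exact .step h (ih h')

theorem AtomSubStep.ren {ξ : ℕ → ℕ} {Q₁ Q₂ : AtomSrt} (h : AtomSubStep Sg Q₁ Q₂) :
    AtomSubStep Sg (Q₁.ren ξ) (Q₂.ren ξ) := by
  induction h with
  | decl h => exact .decl h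
  | app _ ih => exact .app ih

theorem AtomSub.ren {ξ : ℕ → ℕ} {Q₁ Q₂ : AtomSrt} (h : AtomSub Sg Q₁ Q₂) :
    AtomSub Sg (Q₁.ren ξ) (Q₂.ren ξ) := by
  induction h with
  | refl => exact .refl
  | step h _ ih => exact .step h.ren ih

theorem AtomSubStep.exists_hSubQ {k : ℕ} {N : Norm} {α : STy} {Q₁ Q₂ Q₁' : AtomSrt}
    (h : AtomSubStep Sg Q₁ Q₂) (h₁ : HSubQ k N α Q₁ Q₁') :
    ∃ Q₂', HSubQ k N α Q₂ Q₂' ∧ AtomSubStep Sg Q₁' Q₂' := by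
  induction h generalizing Q₁' with
  | decl h => cases h₁; exact ⟨_, .const, .decl h⟩
  | app _ ih =>
    obtain _ | ⟨h₁, hN⟩ := h₁
    obtain ⟨Q, hQ, h⟩ := ih h₁
    exact ⟨_, .app hQ hN, .app h⟩

theorem AtomSub.hSub {k : ℕ} {N : Norm} {α : STy} {Q₁ Q₂ Q₁' Q₂' : AtomSrt}
    (h : AtomSub Sg Q₁ Q₂) (h₁ : HSubQ k N α Q₁ Q₁') (h₂ : HSubQ k N α Q₂ Q₂') :
    AtomSub Sg Q₁' Q₂' := by
  induction h generalizing Q₁' with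
  | refl => rw [h₁.functional h₂]; exact .refl
  | step h _ ih =>
    obtain ⟨Q, hQ, h⟩ := h.exists_hSubQ h₁
    exact .step h (ih hQ h₂)

/-- A family of partial operations on sorts, indexed by `ι`, that commutes with the sort
constructors, passing from `n` to `next n` under a binder, and respects atomic subsorting.
Renaming and hereditary substitution are the two instances. -/
structure SrtAction (Sg : Sig) {ι : Type} (next : ι → ι) (E : ι → Srt → Srt → Prop) : Prop where
  top : ∀ {n W}, E n .top W → W = .top
  inter : ∀ {n S T W}, E n (.inter S T) W → ∃ S' T', W = .inter S' T' ∧ E n S S' ∧ E n T T'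
  pi : ∀ {n S A T W}, E n (.pi S A T) W →
    ∃ S' A' T', W = .pi S' A' T' ∧ E n S S' ∧ E (next n) T T'
  atom : ∀ {n Q W}, E n (.atom Q) W → ∃ Q', W = .atom Q'
  atomSub : ∀ {n Q₁ Q₂ Q₁' Q₂'}, E n (.atom Q₁) (.atom Q₁') → E n (.atom Q₂) (.atom Q₂') →
    AtomSub Sg Q₁ Q₂ → AtomSub Sg Q₁' Q₂'

theorem SrtAction.ren (Sg : Sig) : SrtAction Sg upRen fun ξ S S' => S' = S.ren ξ where
  top h := h
  inter h := ⟨_, _, h, rfl, rfl⟩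
  pi h := ⟨_, _, _, h, rfl, rfl⟩
  atom h := ⟨_, h⟩
  atomSub h₁ h₂ h := by
    cases h₁; cases h₂
    exact h.ren

theorem SrtAction.hSub (Sg : Sig) (α : STy) :
    SrtAction Sg (fun n : ℕ × Norm => (n.1 + 1, n.2.shift)) fun n => HSubS n.1 n.2 α where
  top h := by cases h; rfl
  inter h := by cases h with | inter h₁ h₂ => exact ⟨_, _, rfl, h₁, h₂⟩
  pi h := by cases h with | pi h₁ _ h₂ => exact ⟨_, _, _, rfl, h₁, h₂⟩
  atom h := by cases h; exact ⟨_, rfl⟩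
  atomSub h₁ h₂ h := by
    cases h₁ with | atom h₁ => cases h₂ with | atom h₂ => exact h.hSub h₁ h₂

section Action

variable {ι : Type} {next : ι → ι} {E : ι → Srt → Srt → Prop}

theorem HasConjunct.map (hE : SrtAction Sg next E) {n : ι} {S V S' : Srt} (h : HasConjunct S V)
    (hS : E n S S') : ∃ V', E n V V' ∧ HasConjunct S' V' := by
  induction h generalizing S' with
  | refl => exact ⟨_, hS, .refl _⟩
  | left _ ih =>
    obtain ⟨_, _, rfl, h, -⟩ := hE.inter hS
    obtain ⟨V', hV, h⟩ := ih h
    exact ⟨V', hV, .left h⟩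
  | right _ ih =>
    obtain ⟨_, _, rfl, -, h⟩ := hE.inter hS
    obtain ⟨V', hV, h⟩ := ih h
    exact ⟨V', hV, .right h⟩

theorem AlgSub.map (hE : SrtAction Sg next E) {n : ι} {Δ Δ' : Set Srt} {α : STy} {T T' : Srt}
    (h : AlgSub Sg α Δ T) (hΔ : ∀ V ∈ Δ, ∃ V' ∈ Δ', E n V V') (hT : E n T T') :
    AlgSub Sg α Δ' T' := by
  match α, T with
  | _, .top =>
    rw [hE.top hT]
    simp only [AlgSub]
  | α, .inter T₁ T₂ =>
    obtain ⟨_, _, rfl, h₁, h₂⟩ := hE.inter hT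
    simp only [AlgSub] at h ⊢
    exact ⟨AlgSub.map hE h.1 hΔ h₁, AlgSub.map hE h.2 hΔ h₂⟩
  | _, .atom Q =>
    obtain ⟨Q₁, rfl⟩ := hE.atom hT
    simp only [AlgSub] at h ⊢
    obtain ⟨V, hV, Q', hQ', hs⟩ := h
    obtain ⟨V', hV', hVV'⟩ := hΔ V hV
    obtain ⟨W, hW, hc⟩ := hQ'.map hE hVV'
    obtain ⟨Q'', rfl⟩ := hE.atom hW
    exact ⟨V', hV', Q'', hc, hE.atomSub hW hT hs⟩
  | .base _, .pi _ _ _ => simp only [AlgSub] at h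
  | .arr α β, .pi U A T =>
    obtain ⟨U', A', T', rfl, hU, hT⟩ := hE.pi hT
    simp only [AlgSub] at h ⊢
    refine AlgSub.map hE h ?_ hT
    rintro W ⟨V, hV, S, B, hc, hs⟩
    obtain ⟨V', hV', hVV'⟩ := hΔ V hV
    obtain ⟨_, hX, hc'⟩ := hc.map hE hVV'
    obtain ⟨S', B', W', rfl, hS, hW⟩ := hE.pi hX
    have hU' : ∀ V ∈ ({U} : Set Srt), ∃ V' ∈ ({U'} : Set Srt), E n V V' := by simpa using hU
    exact ⟨W', ⟨V', hV', S', B', hc', AlgSub.map hE hs hU' hS⟩, hW⟩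
termination_by (α, T)

end Action

theorem AlgSub.ren {α : STy} {ξ : ℕ → ℕ} {Δ Δ' : Set Srt} {T : Srt} (h : AlgSub Sg α Δ T)
    (hΔ : ∀ V ∈ Δ, V.ren ξ ∈ Δ') : AlgSub Sg α Δ' (T.ren ξ) :=
  h.map (SrtAction.ren Sg) (n := ξ) (fun V hV => ⟨_, hΔ V hV, rfl⟩) rfl

theorem AlgSub.mono {α : STy} {Δ Δ' : Set Srt} {T : Srt} (h : AlgSub Sg α Δ T)
    (hΔ : Δ ⊆ Δ') : AlgSub Sg α Δ' T := by
  have := h.ren (ξ := id) (Δ' := Δ') fun V hV => by rw [V.ren_id]; exact hΔ hV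
  rwa [T.ren_id] at this

theorem AlgSub.of_ren {α : STy} {ξ ζ : ℕ → ℕ} (hζ : Function.LeftInverse ζ ξ) {S T : Srt}
    (h : AlgSub Sg α {S.ren ξ} (T.ren ξ)) : AlgSub Sg α {S} T := by
  have := h.ren (ξ := ζ) (Δ' := {S}) (by simp [Srt.ren_ren, hζ.comp_eq_id, Srt.ren_id])
  rwa [Srt.ren_ren, hζ.comp_eq_id, Srt.ren_id] at this

theorem AlgSub.hSub {γ α : STy} {k : ℕ} {N : Norm} {Δ Δ' : Set Srt} {T T' : Srt}
    (h : AlgSub Sg γ Δ T) (hΔ : ∀ V ∈ Δ, ∃ V' ∈ Δ', HSubS k N α V V')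
    (hT : HSubS k N α T T') : AlgSub Sg γ Δ' T' :=
  h.map (SrtAction.hSub Sg α) (n := (k, N)) hΔ hT

theorem AlgSub.of_hasConjunct {Δ : Set Srt} {V S : Srt} {A : Ty} (hV : V ∈ Δ)
    (h : HasConjunct V S) (hS : PreRefines S A) : AlgSub Sg A.erase Δ S := by
  induction hS generalizing Δ V with
  | atom => simp only [AlgSub]; exact ⟨V, hV, _, h, .refl⟩
  | @pi S _ A _ _ _ ihS ihT =>
    simp only [Ty.erase, AlgSub]
    exact ihT ⟨V, hV, S, A, h, ihS rfl (.refl S)⟩ (.refl _)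
  | top => simp only [AlgSub]
  | inter _ _ ih₁ ih₂ =>
    simp only [AlgSub]
    exact ⟨ih₁ hV (h.trans (.left (.refl _))), ih₂ hV (h.trans (.right (.refl _)))⟩

theorem AlgSub.refl {S : Srt} {A : Ty} (hS : PreRefines S A) : AlgSub Sg A.erase {S} S :=
  .of_hasConjunct rfl (.refl S) hS

end AlgorithmicSubsorting

/-! ### Checking an η-expansion -/

section EtaChecking

variable {Sg : Sig}

theorem Lookup.of_append {Γ : Ctx} {S : Srt} {A : Ty} : ∀ {Ξ : Ctx} {V : Srt},
    Lookup (Ξ ++ (S, A) :: Γ) Ξ.length V → V = S.ren (· + (Ξ.length + 1))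
  | [], _, .zero _ _ _ => rfl
  | _ :: _, _, .succ _ h => by
    rw [Lookup.of_append h, Srt.shift, Srt.ren_ren]
    rfl

/-- In every extension of `Γ`, the sorts synthesized by `R` are conjuncts of sorts in `Δ`.
Quantifying over extensions makes the notion stable under weakening. -/
def SynthWithin (Sg : Sig) (Γ : Ctx) (R : Atom) (Δ : Set Srt) : Prop :=
  ∀ (Ξ : Ctx) (V : Srt), SortSynth Sg (Ξ ++ Γ) (R.ren (· + Ξ.length)) V →
    ∃ S ∈ Δ, HasConjunct (S.ren (· + Ξ.length)) V

theorem SynthWithin.var (Sg : Sig) (Γ Ξ : Ctx) (S : Srt) (A : Ty) :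
    SynthWithin Sg (Ξ ++ (S, A) :: Γ) (.var Ξ.length) {S.ren (· + (Ξ.length + 1))} := by
  intro Ξ' V h
  obtain ⟨U, hU, hV⟩ := h.exists_directSynth
  obtain _ | hU | _ := hU
  have hlen : Ξ.length + Ξ'.length = (Ξ' ++ Ξ).length := by
    rw [List.length_append, Nat.add_comm]
  simp only [← List.append_assoc, hlen] at hU
  refine ⟨_, rfl, ?_⟩
  rw [hU.of_append] at hV
  rw [Srt.ren_ren]
  convert hV using 3
  simp only [Function.comp]
  omega

theorem SynthWithin.app_eta {Γ : Ctx} {R : Atom} {Δ : Set Srt} {U : Srt} {A A' B : Ty}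
    {p : Srt → Prop} (hR : SynthWithin Sg Γ R Δ) (hΔ : ∀ V ∈ Δ, PreRefines V (.pi A B))
    (hp : ∀ (Ξ : Ctx) (S : Srt), PreRefines S A →
      SortCheck Sg (Ξ ++ (U, A') :: Γ) (eta A.erase (.var Ξ.length))
        (S.ren (· + (Ξ.length + 1))) → p S) :
    SynthWithin Sg ((U, A') :: Γ) (.app R.shift (eta A.erase (.var 0))) (codomains Δ p) := by
  intro Ξ V hV
  have hweak : (fun i => i + Ξ.length) ∘ Nat.succ = (· + (Ξ.length + 1)) := by
    funext i
    simp only [Function.comp]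
    omega
  have hinst : instRen 0 Ξ.length ∘ upRen (· + (Ξ.length + 1)) = (· + Ξ.length) := by
    funext i
    cases i <;> simp [upRen, instRen]
    omega
  obtain ⟨W, hW, hWV⟩ := hV.exists_directSynth
  obtain _ | _ | ⟨hR', hη, hsub⟩ := hW
  rw [Atom.shift, Atom.ren_ren, hweak] at hR'
  rw [eta_ren, Atom.ren, Nat.zero_add] at hη hsub
  obtain ⟨X, hX, hc⟩ := hR (Ξ ++ [(U, A')]) _ (by simpa using hR')
  obtain ⟨Y, hXY, hY⟩ := hc.of_ren
  have hYp := (hΔ X hX).of_hasConjunct hXY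
  cases Y <;> cases hY
  obtain _ | ⟨hS, -⟩ := hYp
  rw [Ty.erase_ren] at hsub
  obtain rfl := hsub.eta_var
  rw [Srt.ren_ren, List.length_append, List.length_singleton, hinst] at hWV
  rw [List.length_append, List.length_singleton] at hη
  exact ⟨_, ⟨X, hX, _, _, hXY, hp Ξ _ hS hη⟩, hWV⟩

theorem SortCheck.algSub {Γ : Ctx} {R : Atom} {Δ : Set Srt} {T : Srt} {A : Ty} {α : STy}
    (hα : A.erase = α) (hR : SynthWithin Sg Γ R Δ) (hΔ : ∀ V ∈ Δ, PreRefines V A)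
    (hT : PreRefines T A) (h : SortCheck Sg Γ (eta α R) T) : AlgSub Sg α Δ T := by
  match T, hT, α, h with
  | .top, _, _, _ => simp only [AlgSub]
  | .inter _ _, .inter hT₁ hT₂, _, h =>
    obtain ⟨h₁, h₂⟩ := sortCheck_inter_iff.1 h
    simp only [AlgSub]
    exact ⟨h₁.algSub hα hR hΔ hT₁, h₂.algSub hα hR hΔ hT₂⟩
  | .atom Q, .atom _, .base a, .switch h hs =>
    obtain ⟨S, hS, hV⟩ := hR [] _ (R.ren_id.symm ▸ h)
    simp only [AlgSub]
    exact ⟨S, hS, _, S.ren_id ▸ hV, hs⟩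
  | .atom Q, .atom _, .arr _ _, h => nomatch h
  | .pi U A T, .pi (B := B) hU hT, .arr _ _, .lam h =>
    obtain ⟨rfl, rfl⟩ := STy.arr.inj hα
    simp only [AlgSub]
    refine SortCheck.algSub rfl (hR.app_eta hΔ fun Ξ S hS h => ?_) ?_ hT h
    · have hU' := SortCheck.algSub (A.erase_ren _) (SynthWithin.var Sg Γ Ξ U A)
        (by simpa using hU.ren _) (hS.ren _) h
      exact hU'.of_ren (ζ := (· - (Ξ.length + 1))) (by intro i; simp)
    · rintro W ⟨V, hV, S, C, hc, -⟩
      obtain _ | ⟨-, hW⟩ := (hΔ V hV).of_hasConjunct hc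
      exact hW
termination_by (α, T)

end EtaChecking


/-! ### Narrowing and subsumption -/

/-- `CtxSub Sg Γ' Γ`: the contexts declare the same types, and each sort in `Γ'` is an algorithmic
subsort of the corresponding one in `Γ`. -/
inductive CtxSub (Sg : Sig) : Ctx → Ctx → Prop
  | nil : CtxSub Sg [] []
  | cons {Γ' Γ : Ctx} {S' S : Srt} {A : Ty} :
      CtxSub Sg Γ' Γ → PreRefines S' A → PreRefines S A → AlgSub Sg A.erase {S'} S →
      CtxSub Sg ((S', A) :: Γ') ((S, A) :: Γ)

section Narrowing

variable {Sg : Sig} {Γ Γ' : Ctx}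

theorem CtxSub.refl (hΓ : ∀ d ∈ Γ, PreRefines d.1 d.2) : CtxSub Sg Γ Γ := by
  induction Γ with
  | nil => exact .nil
  | cons d Γ ih =>
    obtain ⟨hd, hΓ⟩ := List.forall_mem_cons.1 hΓ
    exact .cons (ih hΓ) hd hd (.refl hd)

theorem CtxSub.erase_eq (h : CtxSub Sg Γ' Γ) : Γ'.erase = Γ.erase := by
  induction h with
  | nil => rfl
  | cons _ _ _ _ ih => exact congrArg (List.cons _) ih

theorem CtxSub.preRefines_left (h : CtxSub Sg Γ' Γ) : ∀ d ∈ Γ', PreRefines d.1 d.2 := by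
  induction h with
  | nil => simp
  | cons _ hS' _ _ ih => exact List.forall_mem_cons.2 ⟨hS', ih⟩

theorem CtxSub.preRefines_right (h : CtxSub Sg Γ' Γ) : ∀ d ∈ Γ, PreRefines d.1 d.2 := by
  induction h with
  | nil => simp
  | cons _ _ hS _ ih => exact List.forall_mem_cons.2 ⟨hS, ih⟩

theorem CtxSub.exists_lookup (h : CtxSub Sg Γ' Γ) {i : ℕ} {S : Srt} {A : Ty} (hS : Lookup Γ i S)
    (hA : LookupTy Γ.erase i A) : ∃ S', Lookup Γ' i S' ∧ AlgSub Sg A.erase {S'} S := by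
  induction hS generalizing Γ' A with
  | zero =>
    obtain _ | ⟨_, _, _, h⟩ := h
    cases hA
    refine ⟨_, .zero _ _ _, ?_⟩
    rw [Ty.shift, Ty.erase_ren]
    exact h.ren fun V hV => congrArg Srt.shift hV
  | succ d _ ih =>
    obtain _ | ⟨h, _, _, _⟩ := h
    obtain _ | ⟨_, hA⟩ := hA
    obtain ⟨S', hS', hs⟩ := ih h hA
    refine ⟨_, .succ _ hS', ?_⟩
    rw [Ty.shift, Ty.erase_ren]
    exact hs.ren fun V hV => congrArg Srt.shift hV

theorem SortCheck.of_hasConjunct {N : Norm} {S V : Srt} (hS : SortCheck Sg Γ N S)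
    (h : HasConjunct S V) : SortCheck Sg Γ N V :=
  h.transport (p := SortCheck Sg Γ N) (fun _ _ => sortCheck_inter_iff.1) hS

theorem AlgSub.sortSynth_app (hSg : SigOK Sg) (hΓ : ∀ d ∈ Γ, PreRefines d.1 d.2) {R : Atom}
    {N : Norm} {S T T' : Srt} {A B C : Ty} (hR : TmSynth Sg Γ.erase R (.pi A B))
    (hC : HSubA 0 N A.erase B C) (hT : HSubS 0 N A.erase T T')
    (h : AlgSub Sg (Ty.pi A B).erase {V | SortSynth Sg Γ R V} (.pi S A T))
    (hN : ∀ U, PreRefines U A → AlgSub Sg A.erase {S} U → SortCheck Sg Γ N U) :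
    AlgSub Sg C.erase {V | SortSynth Sg Γ (.app R N) V} T' := by
  simp only [Ty.erase, AlgSub] at h
  rw [hC.erase_eq]
  refine h.hSub ?_ hT
  rintro W ⟨V, hV, U, A', hc, hs⟩
  have hRU : SortSynth Sg Γ R (.pi U A' W) := SortSynth.of_hasConjunct hV hc
  obtain _ | ⟨hU, hW⟩ := hRU.preRefines hSg hΓ hR
  obtain ⟨W', hW'⟩ := hW.exists_hSubS hC
  exact ⟨W', .app hRU (hN U hU hs) hW', hW'⟩

mutual
theorem SortSynth.algSub_of_ctxSub (hSg : SigOK Sg) {Γ Γ' : Ctx} {R : Atom} {A : Ty} {V : Srt}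
    (hΓ : CtxSub Sg Γ' Γ) (hR : TmSynth Sg Γ.erase R A) (h : SortSynth Sg Γ R V) :
    AlgSub Sg A.erase {W | SortSynth Sg Γ' R W} V := by
  obtain ⟨S, hS, hSV⟩ := h.exists_directSynth
  refine hSV.transport (fun _ _ h => by simpa only [AlgSub] using h) ?_
  match R, hS, hR with
  | .const c, .const hS, .const hA =>
    obtain ⟨B, hB, hSB⟩ := hSg.exists_tmConst hS
    obtain rfl := hSg.tmConst_unique hA hB
    exact AlgSub.of_hasConjunct (SortSynth.const hS) (.refl _) hSB
  | .var i, .var hS, .var hA =>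
    obtain ⟨S', hS', hs⟩ := hΓ.exists_lookup hS hA
    exact hs.mono (by rintro _ rfl; exact .var hS')
  | .app R N, .app hRS hNS hT, .app hR hN hC =>
    obtain _ | ⟨hS, -⟩ := hRS.preRefines hSg hΓ.preRefines_right hR
    have ih := hRS.algSub_of_ctxSub hSg hΓ hR
    rw [← hΓ.erase_eq] at hR hN
    refine AlgSub.sortSynth_app hSg hΓ.preRefines_left hR hC hT ih fun U hU hs => ?_
    exact SortCheck.of_algSub hSg hN (by rintro _ rfl; exact ⟨hS, _, hΓ, hNS⟩) hU hs
termination_by (sizeOf R, 0)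
/-- Since the sorts in `Δ` may be checked in different contexts, subsumption and narrowing can be
proved together by recursion on terms. -/
theorem SortCheck.of_algSub (hSg : SigOK Sg) {Γ' : Ctx} {N : Norm} {A : Ty} {Δ : Set Srt}
    {T : Srt} (hN : TmCheck Sg Γ'.erase N A)
    (hΔ : ∀ V ∈ Δ, PreRefines V A ∧ ∃ Γ, CtxSub Sg Γ' Γ ∧ SortCheck Sg Γ N V)
    (hT : PreRefines T A) (h : AlgSub Sg A.erase Δ T) : SortCheck Sg Γ' N T := by
  match N, T, A, hT, hN with
  | _, .top, _, _, _ => exact .top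
  | _, .inter _ _, _, .inter hT₁ hT₂, hN =>
    simp only [AlgSub] at h
    exact .inter (SortCheck.of_algSub hSg hN hΔ hT₁ h.1) (SortCheck.of_algSub hSg hN hΔ hT₂ h.2)
  | .atom R, .atom Q, .atom P, .atom _, .switch hR =>
    simp only [AlgSub] at h
    obtain ⟨V, hV, Q₁, hc, hs⟩ := h
    obtain ⟨-, Γ, hΓ, hRV⟩ := hΔ V hV
    obtain ⟨hRQ, hs'⟩ := hRV.of_hasConjunct hc
    have hRQ' := hRQ.algSub_of_ctxSub hSg hΓ (hΓ.erase_eq ▸ hR)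
    simp only [AlgSub] at hRQ'
    obtain ⟨W, hW, Q₃, hc', hs''⟩ := hRQ'
    exact .switch (SortSynth.of_hasConjunct hW hc') ((hs''.trans hs').trans hs)
  | .lam _, .atom _, _, .atom _, hN | .atom _, .pi _ _ _, _, .pi _ _, hN => nomatch hN
  | .lam N, .pi U A T, .pi _ _, .pi hU hT, .lam hN =>
    simp only [Ty.erase, AlgSub] at h
    refine .lam (SortCheck.of_algSub hSg (Γ' := (U, A) :: Γ') hN ?_ hT h)
    rintro W ⟨V, hV, S, A', hc, hs⟩
    obtain ⟨hVA, Γ, hΓ, hNV⟩ := hΔ V hV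
    obtain _ | ⟨hS, hW⟩ := hVA.of_hasConjunct hc
    obtain _ | hNW := hNV.of_hasConjunct hc
    exact ⟨hW, _, .cons hΓ hU hS hs, hNW⟩
termination_by (sizeOf N, sizeOf T)
end

theorem SortCheck.narrow (hSg : SigOK Sg) {N : Norm} {S : Srt} {A : Ty} (h : SortCheck Sg Γ N S)
    (hΓ : CtxSub Sg Γ' Γ) (hN : TmCheck Sg Γ.erase N A) (hS : PreRefines S A) :
    SortCheck Sg Γ' N S :=
  SortCheck.of_algSub hSg (hΓ.erase_eq ▸ hN) (Δ := {S}) (by rintro _ rfl; exact ⟨hS, Γ, hΓ, h⟩)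
    hS (.refl hS)

theorem ClsSynth.narrow (hSg : SigOK Sg) (hΓ : CtxSub Sg Γ' Γ) {Q : AtomSrt} {P : AtomTy}
    {L : Cls} {K : Knd} (h : ClsSynth Sg Γ Q P L) (hP : TySynth Sg Γ.erase P K) :
    ClsSynth Sg Γ' Q P L := by
  induction h generalizing K with
  | const h => exact .const h
  | app h hN hL ih =>
    obtain _ | ⟨hP, hNA, _⟩ := hP
    obtain _ | ⟨hS, -⟩ := h.clsPreRefines hSg hP
    exact .app (ih hP) (hN.narrow hSg hΓ hNA hS) hL
  | interE₁ _ ih => exact .interE₁ (ih hP)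
  | interE₂ _ ih => exact .interE₂ (ih hP)

theorem Refines.narrow (hSg : SigOK Sg) (hΓ : CtxSub Sg Γ' Γ) {S : Srt} {A : Ty}
    (h : Refines Sg Γ S A) (hA : TyOK Sg Γ.erase A) : Refines Sg Γ' S A := by
  induction h generalizing Γ' with
  | atom h =>
    obtain hP | _ := hA
    exact .atom (h.narrow hSg hΓ hP)
  | pi hS _ ihS ihT =>
    obtain _ | ⟨hA, hB⟩ := hA
    exact .pi (ihS hΓ hA) (ihT (.cons hΓ hS.preRefines hS.preRefines (.refl hS.preRefines)) hB)
  | top => exact .top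
  | inter _ _ ih₁ ih₂ => exact .inter (ih₁ hΓ hA) (ih₂ hΓ hA)

end Narrowing

/-! ### From algorithmic to declarative subsorting -/

section Declarative

variable {Sg : Sig} {Γ : Ctx}

theorem Refines.of_hasConjunct {S V : Srt} {A : Ty} (hS : Refines Sg Γ S A)
    (h : HasConjunct S V) : Refines Sg Γ V A :=
  h.transport (p := (Refines Sg Γ · A))
    (fun _ _ h => by cases h with | inter h₁ h₂ => exact ⟨h₁, h₂⟩) hS

theorem DeclSub.of_hasConjunct {S V : Srt} {A : Ty} (hS : Refines Sg Γ S A)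
    (h : HasConjunct S V) : DeclSub Sg Γ S V A := by
  induction h with
  | refl => exact .refl hS
  | left _ ih => cases hS with | inter h₁ h₂ => exact .interL₁ h₂ (ih h₁)
  | right _ ih => cases hS with | inter h₁ h₂ => exact .interL₂ h₁ (ih h₂)

theorem DeclSub.refines {S T : Srt} {A : Ty} (h : DeclSub Sg Γ S T A) :
    Refines Sg Γ S A ∧ Refines Sg Γ T A := by
  induction h with
  | atomic h₁ h₂ _ => exact ⟨h₁, h₂⟩
  | refl h => exact ⟨h, h⟩
  | trans _ _ ih₁ ih₂ => exact ⟨ih₁.1, ih₂.2⟩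
  | pi hT₁ _ _ ihS ihT => exact ⟨.pi ihS.2 hT₁, .pi ihS.1 ihT.2⟩
  | topR h => exact ⟨h, .top⟩
  | interR _ _ ih₁ ih₂ => exact ⟨ih₁.1, .inter ih₁.2 ih₂.2⟩
  | interL₁ h _ ih => exact ⟨.inter ih.1 h, ih.2⟩
  | interL₂ h _ ih => exact ⟨.inter h ih.1, ih.2⟩
  | topPi h => exact ⟨.top, .pi h .top⟩
  | interPi h h₁ h₂ => exact ⟨.inter (.pi h h₁) (.pi h h₂), .pi h (.inter h₁ h₂)⟩

/-- A filter, in the sense of order theory, in the sorts that refine `A` in `Γ`, preordered by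
declarative subsorting. -/
structure SrtFilter (Sg : Sig) (Γ : Ctx) (A : Ty) (F : Set Srt) : Prop where
  refines : ∀ {T}, T ∈ F → Refines Sg Γ T A
  top_mem : .top ∈ F
  inter_mem : ∀ {T₁ T₂}, T₁ ∈ F → T₂ ∈ F → .inter T₁ T₂ ∈ F
  mem_of_declSub : ∀ {S T}, S ∈ F → DeclSub Sg Γ S T A → T ∈ F

theorem SrtFilter.principal {S : Srt} {A : Ty} (hS : Refines Sg Γ S A) :
    SrtFilter Sg Γ A {T | DeclSub Sg Γ S T A} where
  refines h := h.refines.2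
  top_mem := .topR hS
  inter_mem := .interR
  mem_of_declSub := .trans

/-- This is where the distributivity rules for function sorts are needed. -/
theorem SrtFilter.codomain {A B : Ty} {F : Set Srt} (hF : SrtFilter Sg Γ (.pi A B) F) {U : Srt}
    (hU : Refines Sg Γ U A) : SrtFilter Sg ((U, A) :: Γ) B {T | .pi U A T ∈ F} := by
  have hcod : ∀ {T}, .pi U A T ∈ F → Refines Sg ((U, A) :: Γ) T B := fun hT => by
    cases hF.refines hT with | pi _ h => exact h
  exact {
    refines := hcod
    top_mem := hF.mem_of_declSub hF.top_mem (.topPi hU)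
    inter_mem := fun h₁ h₂ =>
      hF.mem_of_declSub (hF.inter_mem h₁ h₂) (.interPi hU (hcod h₁) (hcod h₂))
    mem_of_declSub := fun hT h => hF.mem_of_declSub hT (.pi (hcod hT) (.refl hU) h) }

theorem SrtFilter.mem_of_algSub (hSg : SigOK Sg) {Γ : Ctx} (hΓ : ∀ d ∈ Γ, PreRefines d.1 d.2)
    {A : Ty} (hA : TyOK Sg Γ.erase A) {F Δ : Set Srt} (hF : SrtFilter Sg Γ A F) (hΔ : Δ ⊆ F)
    {T : Srt} (hT : Refines Sg Γ T A) (h : AlgSub Sg A.erase Δ T) : T ∈ F := by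
  match A, T, hA, hT with
  | _, .top, _, _ => exact hF.top_mem
  | _, .inter _ _, hA, .inter hT₁ hT₂ =>
    simp only [AlgSub] at h
    exact hF.inter_mem (hF.mem_of_algSub hSg hΓ hA hΔ hT₁ h.1)
      (hF.mem_of_algSub hSg hΓ hA hΔ hT₂ h.2)
  | .atom P, .atom Q, _, hQ =>
    simp only [AlgSub] at h
    obtain ⟨V, hV, Q', hc, hs⟩ := h
    have hVA := hF.refines (hΔ hV)
    exact hF.mem_of_declSub (hΔ hV)
      (.trans (.of_hasConjunct hVA hc) (.atomic (hVA.of_hasConjunct hc) hQ hs))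
  | .pi A B, .pi U _ T, .pi hA hB, .pi hU hT =>
    simp only [Ty.erase, AlgSub] at h
    have hΓU : ∀ d ∈ (U, A) :: Γ, PreRefines d.1 d.2 :=
      List.forall_mem_cons.2 ⟨hU.preRefines, hΓ⟩
    refine (hF.codomain hU).mem_of_algSub hSg hΓU hB ?_ hT h
    rintro W ⟨V, hV, S, A', hc, hs⟩
    have hVA := hF.refines (hΔ hV)
    obtain _ | ⟨hS, hW⟩ := hVA.of_hasConjunct hc
    have hUS : DeclSub Sg Γ U S A :=
      (SrtFilter.principal hU).mem_of_algSub hSg hΓ hA (Set.singleton_subset_iff.2 (.refl hU)) hS hs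
    have hW' : Refines Sg ((U, A) :: Γ) W B :=
      hW.narrow hSg (.cons (.refl hΓ) hU.preRefines hS.preRefines hs) hB
    exact hF.mem_of_declSub (hΔ hV)
      (.trans (.of_hasConjunct hVA hc) (.pi hW hUS (.refl hW')))
termination_by (A, T)

end Declarative

end LFR

theorem mainTheorem6 (Sg : LFR.Sig) (Γ : LFR.Ctx) (S T : LFR.Srt) (A : LFR.Ty)
    (hSg : LFR.SigOK Sg) (hΓ : LFR.CtxOK Sg Γ) (hA : LFR.TyOK Sg Γ.erase A)
    (hS : LFR.Refines Sg Γ S A) (hT : LFR.Refines Sg Γ T A)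
    (h : LFR.SortCheck Sg ((S, A) :: Γ) (LFR.eta A.erase (.var 0)) T.shift) :
    LFR.DeclSub Sg Γ S T A := by
  have hshift : LFR.AlgSub Sg A.erase {S.shift} T.shift :=
    h.algSub (A.erase_ren _) (LFR.SynthWithin.var Sg Γ [] S A)
      (by rintro _ rfl; exact hS.preRefines.ren _) (hT.preRefines.ren _)
  have hsub : LFR.AlgSub Sg A.erase {S} T := hshift.of_ren Nat.pred_succ
  exact (LFR.SrtFilter.principal hS).mem_of_algSub hSg hΓ.preRefines hA
    (Set.singleton_subset_iff.2 (.refl hS)) hT hsub
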